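/- **Swing lemma.** Let $L$ be a finite (upper) semimodular lattice, that is, $x\preceq y$ implies $x\vee z\preceq y\vee z$ for all $x,y,z\in L$, and let a planar Hasse diagram of $L$ be fixed (larger elements are higher, covering pairs are drawn as straight line segments, and these segments do not cross). For a prime interval $\mathfrak r=[a,b]$, $a\prec b$ (an edge of the diagram), write $0_{\mathfrak r}=a$ and $1_{\mathfrak r}=b$, and let $\operatorname{con}(\mathfrak r)$ be the least lattice congruence of $L$ that contains the pair $(0_{\mathfrak r},1_{\mathfrak r})$. A *region* of the diagram is given by elements $a<b$ with $a\not\prec b$ and maximal chains $C_1,C_2$ of $[a,b]$ such that $C_1\cap C_2=\{a,b\}$ and every element of $C_2\setminus\{a,b\}$ is on the right of $C_1$; it consists of the elements of $[a,b]$ that are on the right of $C_1$ and on the left of $C_2$ (elements of the chains included). A *4-cell* is a minimal region with exactly four elements; its sides are the edges whose endpoints both belong to it. For distinct prime intervals $\mathfrak r,\mathfrak s$ that are sides of a common 4-cell $S$: 1. $\mathfrak r$ is *cell-perspective* to $\mathfrak s$ if they are opposite sides of $S$; 2. $\mathfrak r$ *swings* to $\mathfrak s$ if $1_{\mathfrak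 r}=1_{\mathfrak s}$, this element has at least three lower covers, and $0_{\mathfrak s}$ is neither the leftmost nor the rightmost of its lower covers; 3. $\mathfrak r$ *tilts* to $\mathfrak s$ if $0_{\mathfrak r}=0_{\mathfrak s}$, this element has at least three covers, and $1_{\mathfrak s}$ is neither the leftmost nor the rightmost of its covers. An *SL-sequence from $\mathfrak p$ to $\mathfrak q$* is a sequence $\mathfrak r_0,\mathfrak r_1,\dots,\mathfrak r_n$ ($n\ge 0$) of prime intervals with $\mathfrak r_0=\mathfrak p$ and $\mathfrak r_n=\mathfrak q$ such that, for each $i\in\{1,\dots,n\}$, $\mathfrak r_{i-1}$ is cell-perspective to, or swings to, or tilts to $\mathfrak r_i$. Then, for all prime intervals $\mathfrak p$ and $\mathfrak q$ of $L$, $(0_{\mathfrak q},1_{\mathfrak q})\in\operatorname{con}(\mathfrak p)$ if and only if there is an SL-sequence from $\mathfrak p$ to $\mathfrak q$. -/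

import Mathlib

/-- Mathlib's upper modular lattices are the semimodular lattices: `x ⪯ y` implies
`x ⊔ z ⪯ y ⊔ z`, where `⪯` means "equal to or covered by". -/
theorem isUpperModularLattice_iff_wcovBy_sup {L : Type*} [Lattice L] :
    IsUpperModularLattice L ↔ ∀ x y z : L, x ⩿ y → x ⊔ z ⩿ y ⊔ z := by
  constructor
  · intro h x y z hxy
    rcases hxy.covBy_or_eq with hc | rfl
    · by_cases hy : y ≤ x ⊔ z
      · have : x ⊔ z = y ⊔ z :=
          le_antisymm (sup_le_sup_right hc.le z) (sup_le hy le_sup_right)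
        exact this ▸ WCovBy.rfl
      · have hinf : y ⊓ (x ⊔ z) = x := by
          rcases hc.eq_or_eq (le_inf hc.le le_sup_left) inf_le_left with h1 | h1
          · exact h1
          · exact absurd (inf_eq_left.mp h1) hy
        have hs : x ⊔ z ⋖ y ⊔ (x ⊔ z) :=
          IsUpperModularLattice.covBy_sup_of_inf_covBy (by rw [hinf]; exact hc)
        rw [← sup_assoc, sup_eq_left.mpr hc.le] at hs
        exact hs.wcovBy
    · exact WCovBy.rfl
  · intro h
    refine ⟨fun {a b} hab => ?_⟩
    have h1 := h (a ⊓ b) a b hab.wcovBy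
    rw [sup_eq_right.mpr inf_le_right] at h1
    refine h1.covBy_of_ne fun he => hab.ne ?_
    exact inf_eq_left.mpr (sup_eq_right.mp he.symm)

/-- A prime interval (an edge of the Hasse diagram): a pair `bot ⋖ top`. -/
@[ext]
structure PrimeInterval (L : Type*) [Lattice L] where
  bot : L
  top : L
  covBy : bot ⋖ top

/-- The least lattice congruence that collapses the prime interval `p`: the intersection of all
lattice congruences that relate `p.bot` and `p.top`. -/
def PrimeInterval.con {L : Type*} [Lattice L] (p : PrimeInterval L) : LatticeCon L where
  r x y := ∀ c : LatticeCon L, c.r p.bot p.top → c.r x y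
  iseqv :=
    { refl := fun x c _ => c.iseqv.refl x
      symm := fun h c hc => c.iseqv.symm (h c hc)
      trans := fun h₁ h₂ c hc => c.iseqv.trans (h₁ c hc) (h₂ c hc) }
  inf := fun h₁ h₂ c hc => c.inf (h₁ c hc) (h₂ c hc)
  sup := fun h₁ h₂ c hc => c.sup (h₁ c hc) (h₂ c hc)

/-- A planar Hasse diagram of `L`. The elements are drawn as distinct points of the plane, larger
elements strictly higher, each covering pair `a ⋖ b` is drawn as the straight line segment between
the two points, and distinct segments meet at most in a point that represents a common endpoint. -/
structure PlanarDiagram (L : Type*) [Lattice L] where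
  pos : L → ℝ × ℝ
  pos_injective : Function.Injective pos
  height_strictMono : StrictMono fun a => (pos a).2
  noncrossing : ∀ r s : PrimeInterval L, r ≠ s →
    segment ℝ (pos r.bot) (pos r.top) ∩ segment ℝ (pos s.bot) (pos s.top) ⊆
      pos '' ({r.bot, r.top} ∩ {s.bot, s.top})

/-- `C` is a maximal chain of the interval `[a, b]`. -/
def IsMaxChainIn {L : Type*} [Lattice L] (a b : L) (C : Set L) : Prop :=
  Maximal (fun C : Set L => C ⊆ Set.Icc a b ∧ IsChain (· ≤ ·) C) C

namespace PlanarDiagram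

variable {L : Type*} [Lattice L] (D : PlanarDiagram L)

/-- The polygonal line along which the chain `C` is drawn: the union of the edges whose endpoints
both lie in `C`. -/
def chainCurve (C : Set L) : Set (ℝ × ℝ) :=
  {P | ∃ u ∈ C, ∃ v ∈ C, u ⋖ v ∧ P ∈ segment ℝ (D.pos u) (D.pos v)}

/-- `z` is on the right of the chain `C` (elements of `C` included): at the height of `z` there is
a point of the polygonal line of `C` whose horizontal coordinate is at most that of `z`. -/
def OnRight (C : Set L) (z : L) : Prop :=
  ∃ P ∈ D.chainCurve C, P.2 = (D.pos z).2 ∧ P.1 ≤ (D.pos z).1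

/-- `z` is on the left of the chain `C` (elements of `C` included). -/
def OnLeft (C : Set L) (z : L) : Prop :=
  ∃ P ∈ D.chainCurve C, P.2 = (D.pos z).2 ∧ (D.pos z).1 ≤ P.1

/-- A region of the diagram: for some `a < b` with `b` not covering `a`, the set of those elements
of `[a, b]` that are on the right of `C₁` and on the left of `C₂`, where `C₁` and `C₂` are maximal
chains of `[a, b]` having only `a` and `b` in common, with `C₂` on the right of `C₁`. -/
def IsRegion (R : Set L) : Prop :=
  ∃ (a b : L) (C₁ C₂ : Set L), a < b ∧ ¬ a ⋖ b ∧ IsMaxChainIn a b C₁ ∧ IsMaxChainIn a b C₂ ∧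
    C₁ ∩ C₂ = {a, b} ∧ (∀ z ∈ C₂ \ {a, b}, D.OnRight C₁ z) ∧
    R = {z | z ∈ Set.Icc a b ∧ D.OnRight C₁ z ∧ D.OnLeft C₂ z}

/-- A cell is a minimal region. -/
def IsCell (R : Set L) : Prop := Minimal D.IsRegion R

/-- A 4-cell is a cell with exactly four elements. -/
def IsFourCell (S : Set L) : Prop := D.IsCell S ∧ S.ncard = 4

/-- The horizontal displacement per unit of height along the straight line from `a` to `b`. -/
noncomputable def inclination (a b : L) : ℝ :=
  ((D.pos b).1 - (D.pos a).1) / ((D.pos b).2 - (D.pos a).2)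

/-- `a` is the leftmost lower cover of `b`: going down from `b`, the edge to `a` is the leftmost
one. -/
def IsLeftmostLowerCover (a b : L) : Prop :=
  a ⋖ b ∧ ∀ c, c ⋖ b → D.inclination c b ≤ D.inclination a b

/-- `a` is the rightmost lower cover of `b`. -/
def IsRightmostLowerCover (a b : L) : Prop :=
  a ⋖ b ∧ ∀ c, c ⋖ b → D.inclination a b ≤ D.inclination c b

/-- `b` is the leftmost cover of `a`: going up from `a`, the edge to `b` is the leftmost one. -/
def IsLeftmostCover (a b : L) : Prop :=
  a ⋖ b ∧ ∀ c, a ⋖ c → D.inclination a b ≤ D.inclination a c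

/-- `b` is the rightmost cover of `a`. -/
def IsRightmostCover (a b : L) : Prop :=
  a ⋖ b ∧ ∀ c, a ⋖ c → D.inclination a c ≤ D.inclination a b

/-- The distinct edges `r` and `s` belong to the 4-cell `S`. -/
def InFourCell (S : Set L) (r s : PrimeInterval L) : Prop :=
  D.IsFourCell S ∧ r ≠ s ∧ r.bot ∈ S ∧ r.top ∈ S ∧ s.bot ∈ S ∧ s.top ∈ S

/-- `r` is cell-perspective to `s`: they are opposite sides of a 4-cell, that is, two sides without
a common endpoint. -/
def CellPerspective (r s : PrimeInterval L) : Prop :=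
  ∃ S, D.InFourCell S r s ∧ Disjoint ({r.bot, r.top} : Set L) {s.bot, s.top}

/-- `r` swings to `s`. -/
def SwingsTo (r s : PrimeInterval L) : Prop :=
  (∃ S, D.InFourCell S r s) ∧ r.top = s.top ∧ 3 ≤ {c | c ⋖ r.top}.encard ∧
    ¬ D.IsLeftmostLowerCover s.bot r.top ∧ ¬ D.IsRightmostLowerCover s.bot r.top

/-- `r` tilts to `s`. -/
def TiltsTo (r s : PrimeInterval L) : Prop :=
  (∃ S, D.InFourCell S r s) ∧ r.bot = s.bot ∧ 3 ≤ {c | r.bot ⋖ c}.encard ∧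
    ¬ D.IsLeftmostCover r.bot s.top ∧ ¬ D.IsRightmostCover r.bot s.top

/-- The sequence `r 0, r 1, …, r n` of prime intervals is an SL-sequence. -/
def IsSLSequence {n : ℕ} (r : Fin (n + 1) → PrimeInterval L) : Prop :=
  ∀ i : Fin n, D.CellPerspective (r i.castSucc) (r i.succ) ∨
    D.SwingsTo (r i.castSucc) (r i.succ) ∨ D.TiltsTo (r i.castSucc) (r i.succ)

end PlanarDiagram

/-! An SL-step never leaves the congruence. For a cell-perspectivity this is immediate. If `[u, x]`
swings to `[v, x]`, then `v` is an inner lower cover of `x`, so some lower cover `e` lies on the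
side of `v` away from `u`. Planarity gives `u ⊓ e ≤ v`, so meeting with `e` and then joining with
`v` collapses `[v, x]`. Tilts are dual.

For the converse, call `[u, v]` reached if it has a maximal chain of edges that are ends of
SL-sequences from `p` (`ReachesChain`). If this relation is preserved by joins and meets with any
element, it yields a congruence `reachesCon` collapsing `p`. It therefore contains `con p`, and an
edge it collapses is itself reached.

Joins reduce to moving a reached edge `[x, y]` to `[z, y ⊔ z]` for another cover `z` of `x`
(`Reaches.sup_of_covBy`). Adjacent covers span a 4-cell, which provides a perspectivity, and a tilt
if `z` is inner. Other pairs are handled through the covers between them, all of which are inner.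
Meets go the same way with swings (`Reaches.inf_of_covBy`), but `[y ⊓ z, z]` need not be an edge, so
an induction on the top element is added. Adjacent lower covers do cover their meet, by planarity
and semimodularity together (`inf_covBy_of_adjacent`).

The geometry rests on one fact: maximal chains are graphs of continuous functions of the height, and
by the intermediate value theorem two of them keep their left-right order until they share an
element. -/

namespace IsMaxChainIn

/-! ### Maximal chains of an interval. -/

variable {L : Type*} [Lattice L] {a b : L} {C : Set L}

theorem bot_le (hC : IsMaxChainIn a b C) {z : L} (hz : z ∈ C) : a ≤ z := (hC.1.1 hz).1

theorem le_top (hC : IsMaxChainIn a b C) {z : L} (hz : z ∈ C) : z ≤ b := (hC.1.1 hz).2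

theorem le_total (hC : IsMaxChainIn a b C) {y z : L} (hy : y ∈ C) (hz : z ∈ C) : y ≤ z ∨ z ≤ y :=
  hC.1.2.total hy hz

/-- The working form of maximality: otherwise `z` could be added to the chain. -/
theorem mem_of_comparable (hC : IsMaxChainIn a b C) {z : L} (hz : z ∈ Set.Icc a b)
    (h : ∀ w ∈ C, z ≤ w ∨ w ≤ z) : z ∈ C :=
  hC.2 ⟨Set.insert_subset hz hC.1.1, hC.1.2.insert fun w hw _ => h w hw⟩
    (Set.subset_insert z C) (Set.mem_insert z C)

theorem bot_mem (hC : IsMaxChainIn a b C) (hab : a ≤ b) : a ∈ C :=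
  hC.mem_of_comparable ⟨le_rfl, hab⟩ fun _ hw => .inl (hC.bot_le hw)

theorem top_mem (hC : IsMaxChainIn a b C) (hab : a ≤ b) : b ∈ C :=
  hC.mem_of_comparable ⟨hab, le_rfl⟩ fun _ hw => .inr (hC.le_top hw)

theorem eq_of_covBy (hC : IsMaxChainIn a b C) {u v w : L} (hv : v ∈ C) (hw : w ∈ C)
    (huv : u ⋖ v) (huw : u ⋖ w) : v = w := by
  rcases hC.le_total hv hw with h | h
  · exact (huw.eq_or_eq huv.le h).resolve_left huv.ne'
  · exact ((huv.eq_or_eq huw.le h).resolve_left huw.ne').symm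

theorem eq_of_covBy' (hC : IsMaxChainIn a b C) {u v w : L} (hv : v ∈ C) (hw : w ∈ C)
    (hvu : v ⋖ u) (hwu : w ⋖ u) : v = w := by
  rcases hC.le_total hv hw with h | h
  · exact ((hvu.eq_or_eq h hwu.le).resolve_right hwu.ne).symm
  · exact (hwu.eq_or_eq h hvu.le).resolve_right hvu.ne

theorem exists_mem [Finite L] {c : L} (hac : a ≤ c) (hcb : c ≤ b) :
    ∃ C, IsMaxChainIn a b C ∧ c ∈ C := by
  obtain ⟨C, hC, hmax⟩ := Finite.exists_le_maximal
    (p := fun C : Set L => C ⊆ Set.Icc a b ∧ IsChain (· ≤ ·) C) (a := {c})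
    ⟨Set.singleton_subset_iff.2 ⟨hac, hcb⟩, IsChain.singleton⟩
  exact ⟨C, hmax, hC rfl⟩

/-- Peeling off the lowest edge is what allows induction along a maximal chain. -/
theorem exists_tail [Finite L] (hC : IsMaxChainIn a b C) (hab : a < b) :
    ∃ a' C', a ⋖ a' ∧ a' ≤ b ∧ IsMaxChainIn a' b C' ∧ C = insert a C' := by
  have haC := hC.bot_mem hab.le
  have hbC := hC.top_mem hab.le
  obtain ⟨a', ha', hmin⟩ := (Set.toFinite (C \ {a})).exists_minimal ⟨b, hbC, hab.ne'⟩
  have hlt : a < a' := lt_of_le_of_ne (hC.bot_le ha'.1) (Ne.symm ha'.2)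
  have hle : ∀ w ∈ C, w ≠ a → a' ≤ w := fun w hw hwa =>
    (hC.le_total ha'.1 hw).elim id fun h => hmin ⟨hw, hwa⟩ h
  have hins : C = insert a (C \ {a}) := by
    rw [Set.insert_sdiff_singleton, Set.insert_eq_of_mem haC]
  refine ⟨a', C \ {a}, ⟨hlt, fun w haw hwa' => ?_⟩, hC.le_top ha'.1,
    ⟨⟨fun w hw => ⟨hle w hw.1 hw.2, hC.le_top hw.1⟩, hC.1.2.mono Set.sdiff_subset⟩, ?_⟩, hins⟩
  · have hw : w ∈ C := hC.mem_of_comparable ⟨haw.le, hwa'.le.trans (hC.le_top ha'.1)⟩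
      fun z hz => by
        by_cases hza : z = a
        · exact .inr (hza ▸ haw.le)
        · exact .inl (hwa'.le.trans (hle z hz hza))
    exact hwa'.not_ge (hle w hw haw.ne')
  · intro C'' ⟨hsub, hchain⟩ hle' z hz
    have hane : z ≠ a := fun h => hlt.not_ge (h ▸ (hsub hz).1)
    refine ⟨hC.2 (y := insert a C'') ⟨?_, ?_⟩ ?_ (Set.mem_insert_of_mem a hz), hane⟩
    · exact Set.insert_subset ⟨le_rfl, hab.le⟩ fun w hw => ⟨hlt.le.trans (hsub hw).1, (hsub hw).2⟩
    · exact hchain.insert fun w hw _ => .inl (hlt.le.trans (hsub hw).1)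
    · rw [hins]
      exact Set.insert_subset_insert hle'

theorem exists_covBy_mem [Finite L] (hC : IsMaxChainIn a b C) (hab : a < b) :
    ∃ v ∈ C, a ⋖ v := by
  obtain ⟨v, C', hav, hvb, hC', rfl⟩ := hC.exists_tail hab
  exact ⟨v, .inr (hC'.bot_mem hvb), hav⟩

theorem of_covBy_covBy {y : L} (hay : a ⋖ y) (hyb : y ⋖ b) : IsMaxChainIn a b {a, y, b} := by
  refine ⟨⟨?_, ?_⟩, ?_⟩
  · rintro z (rfl | rfl | rfl)
    exacts [⟨le_rfl, (hay.lt.trans hyb.lt).le⟩, ⟨hay.le, hyb.le⟩, ⟨(hay.lt.trans hyb.lt).le, le_rfl⟩]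
  · refine (IsChain.singleton.insert ?_).insert ?_
    · rintro z rfl _
      exact .inl hyb.le
    · rintro z (rfl | rfl) _
      exacts [.inl hay.le, .inl (hay.lt.trans hyb.lt).le]
  · intro C ⟨hsub, hch⟩ hle z hz
    rcases hch.total hz (hle (.inr (.inl rfl))) with h | h
    · rcases hay.eq_or_eq (hsub hz).1 h with rfl | rfl
      exacts [.inl rfl, .inr (.inl rfl)]
    · rcases hyb.eq_or_eq h (hsub hz).2 with rfl | rfl
      exacts [.inr (.inl rfl), .inr (.inr rfl)]

end IsMaxChainIn

/-! ### Maximal chains as graphs of functions of the height. -/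

namespace PlanarDiagram

variable {L : Type*} [Lattice L] (D : PlanarDiagram L)

theorem height_lt {u v : L} (h : u < v) : (D.pos u).2 < (D.pos v).2 := D.height_strictMono h

theorem height_le {u v : L} (h : u ≤ v) : (D.pos u).2 ≤ (D.pos v).2 :=
  D.height_strictMono.monotone h

theorem mem_segment_iff {u v : L} (h : u < v) (P : ℝ × ℝ) :
    P ∈ segment ℝ (D.pos u) (D.pos v) ↔ ((D.pos u).2 ≤ P.2 ∧ P.2 ≤ (D.pos v).2) ∧
      P.1 = (D.pos u).1 + D.inclination u v * (P.2 - (D.pos u).2) := by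
  have hh : 0 < (D.pos v).2 - (D.pos u).2 := sub_pos.2 (D.height_lt h)
  rw [segment_eq_image']
  unfold inclination
  constructor
  · rintro ⟨s, ⟨h0, h1⟩, rfl⟩
    simp only [Prod.snd_add, Prod.smul_snd, Prod.snd_sub, smul_eq_mul, Prod.fst_add, Prod.smul_fst,
      Prod.fst_sub]
    refine ⟨⟨by nlinarith, by nlinarith⟩, ?_⟩
    field_simp
    ring
  · rintro ⟨⟨h0, h1⟩, h2⟩
    refine ⟨(P.2 - (D.pos u).2) / ((D.pos v).2 - (D.pos u).2),
      ⟨div_nonneg (by linarith) hh.le, (div_le_one hh).2 (by linarith)⟩, ?_⟩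
    ext
    · simp only [Prod.fst_add, Prod.smul_fst, Prod.fst_sub, smul_eq_mul]
      rw [h2]
      ring
    · simp only [Prod.snd_add, Prod.smul_snd, Prod.snd_sub, smul_eq_mul]
      field_simp
      ring

theorem inclination_mul {u v : L} (h : u < v) :
    D.inclination u v * ((D.pos v).2 - (D.pos u).2) = (D.pos v).1 - (D.pos u).1 :=
  div_mul_cancel₀ _ (sub_pos.2 (D.height_lt h)).ne'

/-- The polygonal line of the maximal chain `C` of `[a, b]` is the graph of `f`, as a function of
the height. -/
structure IsChainGraph (a b : L) (C : Set L) (f : ℝ → ℝ) : Prop where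
  continuous : Continuous f
  vertex : ∀ z ∈ C, f (D.pos z).2 = (D.pos z).1
  edge : ∀ u ∈ C, ∀ v ∈ C, u ⋖ v → ∀ t, (D.pos u).2 ≤ t → t ≤ (D.pos v).2 →
    f t = (D.pos u).1 + D.inclination u v * (t - (D.pos u).2)
  cover : ∀ t, (D.pos a).2 ≤ t → t ≤ (D.pos b).2 → a < b →
    ∃ u ∈ C, ∃ v ∈ C, u ⋖ v ∧ (D.pos u).2 ≤ t ∧ t ≤ (D.pos v).2

theorem exists_isChainGraph [Finite L] {a b : L} {C : Set L} (hab : a ≤ b)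
    (hC : IsMaxChainIn a b C) : ∃ f, D.IsChainGraph a b C f := by
  induction a using WellFoundedGT.induction generalizing C with
  | ind a ih =>
  rcases hab.eq_or_lt with rfl | hlt
  · have hz : ∀ z ∈ C, z = a := fun z hz => le_antisymm (hC.le_top hz) (hC.bot_le hz)
    refine ⟨fun _ => (D.pos a).1, continuous_const, fun z h => by rw [hz z h], ?_,
      fun t _ _ h => absurd h (lt_irrefl _)⟩
    intro u hu v hv huv
    exact absurd ((hz u hu).trans (hz v hv).symm) huv.ne
  · obtain ⟨a', C', haa', ha'b, hC', rfl⟩ := hC.exists_tail hlt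
    obtain ⟨f, hf⟩ := ih a' haa'.lt ha'b hC'
    have ha'C := hC'.bot_mem ha'b
    have hh := D.height_lt haa'.lt
    have hinc := D.inclination_mul haa'.lt
    have hlow : ∀ t, t ≤ (D.pos a').2 → f (max t (D.pos a').2) +
        D.inclination a a' * (min t (D.pos a').2 - (D.pos a').2) =
        (D.pos a).1 + D.inclination a a' * (t - (D.pos a).2) := fun t ht => by
      rw [max_eq_right ht, min_eq_left ht, hf.vertex a' ha'C]
      linarith
    have hhigh : ∀ t, (D.pos a').2 ≤ t → f (max t (D.pos a').2) +
        D.inclination a a' * (min t (D.pos a').2 - (D.pos a').2) = f t := fun t ht => by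
      rw [max_eq_left ht, min_eq_right ht, sub_self, mul_zero, add_zero]
    have hC'lt : ∀ z ∈ C', (D.pos a').2 ≤ (D.pos z).2 := fun z hz => D.height_le (hC'.bot_le hz)
    have hfc := hf.continuous
    -- Truncating at the height of `a'` glues the line of the edge `[a, a']` below to `f` above
    -- without a case split, so continuity is automatic.
    refine ⟨fun t => f (max t (D.pos a').2) +
        D.inclination a a' * (min t (D.pos a').2 - (D.pos a').2), by fun_prop, ?_, ?_, ?_⟩
    · rintro z (rfl | hz)
      · rw [hlow _ hh.le]
        ring
      · exact (hhigh _ (hC'lt z hz)).trans (hf.vertex z hz)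
    · rintro u (rfl | hu) v hv huv t h1 h2
      · have hv' : v = a' := hC.eq_of_covBy hv (.inr ha'C) huv haa'
        subst hv'
        exact hlow t h2
      · rcases hv with rfl | hv
        · exact absurd (haa'.lt.trans_le (hC'.bot_le hu)) huv.lt.not_gt
        · exact (hhigh t ((hC'lt u hu).trans h1)).trans (hf.edge u hu v hv huv t h1 h2)
    · intro t h1 h2 _
      rcases le_total t (D.pos a').2 with h | h
      · exact ⟨a, .inl rfl, a', .inr ha'C, haa', h1, h⟩
      · rcases ha'b.eq_or_lt with rfl | hlt'
        · exact ⟨a, .inl rfl, a', .inr ha'C, haa', h1, h2⟩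
        · obtain ⟨u, hu, v, hv, h'⟩ := hf.cover t h h2 hlt'
          exact ⟨u, .inr hu, v, .inr hv, h'⟩

theorem IsChainGraph.eq_of_mem_chainCurve {D : PlanarDiagram L} {a b : L} {C : Set L} {f : ℝ → ℝ}
    (hf : D.IsChainGraph a b C f) {P : ℝ × ℝ} (hP : P ∈ D.chainCurve C) : f P.2 = P.1 := by
  obtain ⟨u, hu, v, hv, huv, hP⟩ := hP
  obtain ⟨⟨h1, h2⟩, h3⟩ := (D.mem_segment_iff huv.lt P).1 hP
  rw [hf.edge u hu v hv huv _ h1 h2, h3]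

theorem IsChainGraph.mem_chainCurve {D : PlanarDiagram L} {a b : L} {C : Set L} {f : ℝ → ℝ}
    (hf : D.IsChainGraph a b C f) (hab : a < b) {t : ℝ} (h1 : (D.pos a).2 ≤ t)
    (h2 : t ≤ (D.pos b).2) : (f t, t) ∈ D.chainCurve C := by
  obtain ⟨u, hu, v, hv, huv, h3, h4⟩ := hf.cover t h1 h2 hab
  exact ⟨u, hu, v, hv, huv,
    (D.mem_segment_iff huv.lt _).2 ⟨⟨h3, h4⟩, hf.edge u hu v hv huv t h3 h4⟩⟩

theorem IsChainGraph.onRight_iff {D : PlanarDiagram L} {a b : L} {C : Set L} {f : ℝ → ℝ}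
    (hf : D.IsChainGraph a b C f) (hab : a < b) {z : L} (hz : z ∈ Set.Icc a b) :
    D.OnRight C z ↔ f (D.pos z).2 ≤ (D.pos z).1 := by
  constructor
  · rintro ⟨P, hP, h1, h2⟩
    rw [← h1, hf.eq_of_mem_chainCurve hP]
    exact h2
  · exact fun h => ⟨_, hf.mem_chainCurve hab (D.height_le hz.1) (D.height_le hz.2), rfl, h⟩

theorem IsChainGraph.onLeft_iff {D : PlanarDiagram L} {a b : L} {C : Set L} {f : ℝ → ℝ}
    (hf : D.IsChainGraph a b C f) (hab : a < b) {z : L} (hz : z ∈ Set.Icc a b) :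
    D.OnLeft C z ↔ (D.pos z).1 ≤ f (D.pos z).2 := by
  constructor
  · rintro ⟨P, hP, h1, h2⟩
    rw [← h1, hf.eq_of_mem_chainCurve hP]
    exact h2
  · exact fun h => ⟨_, hf.mem_chainCurve hab (D.height_le hz.1) (D.height_le hz.2), rfl, h⟩

/-- Two chains whose polygonal lines meet have a common element or a common edge there. -/
theorem IsChainGraph.exists_common {D : PlanarDiagram L} {a b a' b' : L} {C C' : Set L}
    {f g : ℝ → ℝ} (hf : D.IsChainGraph a b C f) (hg : D.IsChainGraph a' b' C' g) (hab : a < b)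
    (hab' : a' < b') {t : ℝ} (h1 : (D.pos a).2 ≤ t) (h2 : t ≤ (D.pos b).2)
    (h1' : (D.pos a').2 ≤ t) (h2' : t ≤ (D.pos b').2) (hfg : f t = g t) :
    (∃ y ∈ C ∩ C', (D.pos y).2 = t) ∨
      ∃ u ∈ C ∩ C', ∃ v ∈ C ∩ C', u ⋖ v ∧ (D.pos u).2 ≤ t ∧ t ≤ (D.pos v).2 := by
  obtain ⟨u, hu, v, hv, huv, h3, h4⟩ := hf.cover t h1 h2 hab
  obtain ⟨u', hu', v', hv', huv', h3', h4'⟩ := hg.cover t h1' h2' hab'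
  by_cases hr : (⟨u, v, huv⟩ : PrimeInterval L) = ⟨u', v', huv'⟩
  · obtain ⟨rfl, rfl⟩ : u = u' ∧ v = v' := by simpa using hr
    exact .inr ⟨u, ⟨hu, hu'⟩, v, ⟨hv, hv'⟩, huv, h3, h4⟩
  · left
    obtain ⟨y, ⟨hy, hy'⟩, hP⟩ := D.noncrossing _ _ hr
      ⟨(D.mem_segment_iff huv.lt (f t, t)).2 ⟨⟨h3, h4⟩, hf.edge u hu v hv huv t h3 h4⟩,
        (D.mem_segment_iff huv'.lt (f t, t)).2 ⟨⟨h3', h4'⟩,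
          hfg.trans (hg.edge u' hu' v' hv' huv' t h3' h4')⟩⟩
    refine ⟨y, ⟨?_, ?_⟩, by rw [hP]⟩
    · rcases hy with rfl | rfl <;> assumption
    · rcases hy' with rfl | rfl <;> assumption

end PlanarDiagram

/-! ### The left-right order of two chains. -/

theorem lt_iff_lt_of_forall_ne {f g : ℝ → ℝ} (hf : Continuous f) (hg : Continuous g) {s : Set ℝ}
    (hs : IsPreconnected s) (hne : ∀ t ∈ s, f t ≠ g t) {t₁ t₂ : ℝ} (h₁ : t₁ ∈ s) (h₂ : t₂ ∈ s) :
    f t₁ < g t₁ ↔ f t₂ < g t₂ := by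
  have key : ∀ {x y}, x ∈ s → y ∈ s → f x < g x → f y < g y := fun {x y} hx hy h => by
    by_contra hc
    obtain ⟨t, ht, he⟩ := hs.intermediate_value₂ hx hy hf.continuousOn hg.continuousOn h.le
      (not_lt.1 hc)
    exact hne t ht he
  exact ⟨key h₁ h₂, key h₂ h₁⟩

namespace PlanarDiagram

variable {L : Type*} [Lattice L] (D : PlanarDiagram L)

/-- Two chains going up from `a` through different covers keep their left-right order until they
meet again. -/
theorem IsChainGraph.lt_iff_inclination_lt {D : PlanarDiagram L} {a b b' v v' : L} {C C' : Set L}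
    {f g : ℝ → ℝ} (hf : D.IsChainGraph a b C f) (hg : D.IsChainGraph a b' C' g)
    (hC : IsMaxChainIn a b C) (hC' : IsMaxChainIn a b' C') (hv : v ∈ C) (hv' : v' ∈ C')
    (hav : a ⋖ v) (hav' : a ⋖ v') (hne : v ≠ v') {T : ℝ} (hT : (D.pos a).2 < T)
    (hTb : T ≤ (D.pos b).2) (hTb' : T ≤ (D.pos b').2)
    (hcommon : ∀ z ∈ C ∩ C', z ≠ a → T < (D.pos z).2) :
    f T < g T ↔ D.inclination a v < D.inclination a v' := by
  have hab : a < b := hav.lt.trans_le (hC.le_top hv)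
  have hab' : a < b' := hav'.lt.trans_le (hC'.le_top hv')
  have hno : ∀ t ∈ Set.Ioc (D.pos a).2 T, f t ≠ g t := by
    rintro t ⟨h1, h2⟩ he
    rcases hf.exists_common hg hab hab' h1.le (h2.trans hTb) h1.le (h2.trans hTb') he with
      ⟨y, hy, rfl⟩ | ⟨u, hu, w, hw, huw, h3, -⟩
    · exact (hcommon y hy fun h => h1.ne (h ▸ rfl)).not_ge h2
    · have hua : u = a := by
        by_contra h
        exact (hcommon u hu h).not_ge (h3.trans h2)
      subst hua
      exact hne ((hC.eq_of_covBy hv hw.1 hav huw).trans (hC'.eq_of_covBy hv' hw.2 hav' huw).symm)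
  -- At this height neither curve has passed its first vertex above `a`, so both are still straight
  -- and comparing them means comparing inclinations.
  have hs1 : min T (min (D.pos v).2 (D.pos v').2) ∈ Set.Ioc (D.pos a).2 T :=
    ⟨lt_min hT (lt_min (D.height_lt hav.lt) (D.height_lt hav'.lt)), min_le_left _ _⟩
  rw [lt_iff_lt_of_forall_ne hf.continuous hg.continuous Set.ordConnected_Ioc.isPreconnected hno
    ⟨hT, le_rfl⟩ hs1]
  generalize hS : min T (min (D.pos v).2 (D.pos v').2) = S at hs1 ⊢
  have hSv : S ≤ (D.pos v).2 := hS ▸ (min_le_right _ _).trans (min_le_left _ _)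
  have hSv' : S ≤ (D.pos v').2 := hS ▸ (min_le_right _ _).trans (min_le_right _ _)
  rw [hf.edge a (hC.bot_mem hab.le) v hv hav S hs1.1.le hSv,
    hg.edge a (hC'.bot_mem hab'.le) v' hv' hav' S hs1.1.le hSv', add_lt_add_iff_left,
    mul_lt_mul_iff_left₀ (sub_pos.2 hs1.1)]

/-- Two chains going down from `b` through different lower covers keep their left-right order until
they meet again. -/
theorem IsChainGraph.lt_iff_inclination_gt {D : PlanarDiagram L} {a a' b v v' : L} {C C' : Set L}
    {f g : ℝ → ℝ} (hf : D.IsChainGraph a b C f) (hg : D.IsChainGraph a' b C' g)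
    (hC : IsMaxChainIn a b C) (hC' : IsMaxChainIn a' b C') (hv : v ∈ C) (hv' : v' ∈ C')
    (hvb : v ⋖ b) (hvb' : v' ⋖ b) (hne : v ≠ v') {T : ℝ} (hT : T < (D.pos b).2)
    (haT : (D.pos a).2 ≤ T) (haT' : (D.pos a').2 ≤ T)
    (hcommon : ∀ z ∈ C ∩ C', z ≠ b → (D.pos z).2 < T) :
    f T < g T ↔ D.inclination v' b < D.inclination v b := by
  have hab : a < b := (hC.bot_le hv).trans_lt hvb.lt
  have hab' : a' < b := (hC'.bot_le hv').trans_lt hvb'.lt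
  have hno : ∀ t ∈ Set.Ico T (D.pos b).2, f t ≠ g t := by
    rintro t ⟨h1, h2⟩ he
    rcases hf.exists_common hg hab hab' (haT.trans h1) h2.le (haT'.trans h1) h2.le he with
      ⟨y, hy, rfl⟩ | ⟨u, hu, w, hw, huw, -, h3⟩
    · exact (hcommon y hy fun h => h2.ne (h ▸ rfl)).not_ge h1
    · have hwb : w = b := by
        by_contra h
        exact (hcommon w hw h).not_ge (h1.trans h3)
      subst hwb
      exact hne ((hC.eq_of_covBy' hv hu.1 hvb huw).trans
        (hC'.eq_of_covBy' hv' hu.2 hvb' huw).symm)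
  have hs1 : max T (max (D.pos v).2 (D.pos v').2) ∈ Set.Ico T (D.pos b).2 :=
    ⟨le_max_left _ _, max_lt hT (max_lt (D.height_lt hvb.lt) (D.height_lt hvb'.lt))⟩
  rw [lt_iff_lt_of_forall_ne hf.continuous hg.continuous Set.ordConnected_Ico.isPreconnected hno
    ⟨le_rfl, hT⟩ hs1]
  generalize hS : max T (max (D.pos v).2 (D.pos v').2) = S at hs1 ⊢
  have hSv : (D.pos v).2 ≤ S := hS ▸ (le_max_left _ _).trans (le_max_right _ _)
  have hSv' : (D.pos v').2 ≤ S := hS ▸ (le_max_right _ _).trans (le_max_right _ _)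
  rw [hf.edge v hv b (hC.top_mem hab.le) hvb S hSv hs1.2.le,
    hg.edge v' hv' b (hC'.top_mem hab'.le) hvb' S hSv' hs1.2.le]
  -- Going down from `b`, the inclination is subtracted from the horizontal coordinate; hence the
  -- reversed inequality.
  have hmul : D.inclination v' b * ((D.pos b).2 - S) < D.inclination v b * ((D.pos b).2 - S) ↔
      D.inclination v' b < D.inclination v b := mul_lt_mul_iff_left₀ (sub_pos.2 hs1.2)
  rw [← hmul]
  have e1 := D.inclination_mul hvb.lt
  have e2 := D.inclination_mul hvb'.lt
  constructor <;> intro h <;> linarith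

end PlanarDiagram

/-! ### Planarity at the covers and lower covers of an element. -/

namespace PlanarDiagram

variable {L : Type*} [Lattice L] (D : PlanarDiagram L)

/-- Two edges leaving `a` in the same direction would overlap: the lower of the two tops would lie
on the other edge. -/
theorem inclination_left_injOn (a : L) : Set.InjOn (D.inclination a) {v | a ⋖ v} := by
  have key : ∀ v w : L, a ⋖ v → a ⋖ w → D.inclination a v = D.inclination a w →
      (D.pos v).2 ≤ (D.pos w).2 → v = w := by
    intro v w hv hw he hh
    by_contra hne
    have e := D.inclination_mul hv.lt
    obtain ⟨y, ⟨-, hy⟩, hP⟩ := D.noncrossing ⟨a, v, hv⟩ ⟨a, w, hw⟩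
      (fun h => hne (congrArg PrimeInterval.top h))
      ⟨right_mem_segment ℝ (D.pos a) (D.pos v), (D.mem_segment_iff hw.lt _).2
        ⟨⟨(D.height_lt hv.lt).le, hh⟩, by rw [← he]; linarith⟩⟩
    rcases hy with rfl | rfl
    exacts [hv.ne (D.pos_injective hP), hne (D.pos_injective hP).symm]
  intro v hv w hw he
  exact (le_total (D.pos v).2 (D.pos w).2).elim (key v w hv hw he)
    fun h => (key w v hw hv he.symm h).symm

theorem inclination_right_injOn (b : L) : Set.InjOn (D.inclination · b) {v | v ⋖ b} := by
  have key : ∀ v w : L, v ⋖ b → w ⋖ b → D.inclination v b = D.inclination w b →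
      (D.pos w).2 ≤ (D.pos v).2 → v = w := by
    intro v w hv hw he hh
    by_contra hne
    have e := D.inclination_mul hv.lt
    have e' := D.inclination_mul hw.lt
    obtain ⟨y, ⟨-, hy⟩, hP⟩ := D.noncrossing ⟨v, b, hv⟩ ⟨w, b, hw⟩
      (fun h => hne (congrArg PrimeInterval.bot h))
      ⟨left_mem_segment ℝ (D.pos v) (D.pos b), (D.mem_segment_iff hw.lt _).2
        ⟨⟨hh, (D.height_lt hv.lt).le⟩, by rw [← he] at e' ⊢; linarith⟩⟩
    rcases hy with rfl | rfl
    exacts [hne (D.pos_injective hP).symm, hv.ne (D.pos_injective hP).symm]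
  intro v hv w hw he
  exact (le_total (D.pos w).2 (D.pos v).2).elim (key v w hv hw he)
    fun h => (key w v hw hv he.symm h).symm

/-- Two maximal chains of `[a, b]` with no inner common element: one of them is on the left of the
other one at all heights. -/
theorem IsChainGraph.lt_of_inter_eq {D : PlanarDiagram L} {a b v v' : L} {C₁ C₂ : Set L}
    {f g : ℝ → ℝ} (hf : D.IsChainGraph a b C₁ f) (hg : D.IsChainGraph a b C₂ g)
    (h₁ : IsMaxChainIn a b C₁) (h₂ : IsMaxChainIn a b C₂) (hinter : C₁ ∩ C₂ = {a, b})
    (hv : v ∈ C₁) (hv' : v' ∈ C₂) (hav : a ⋖ v) (hav' : a ⋖ v') (hne : v ≠ v')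
    {T : ℝ} (hT : T ∈ Set.Ioo (D.pos a).2 (D.pos b).2) :
    f T < g T ↔ D.inclination a v < D.inclination a v' := by
  refine hf.lt_iff_inclination_lt hg h₁ h₂ hv hv' hav hav' hne hT.1 hT.2.le hT.2.le
    fun z hz hza => ?_
  rw [hinter] at hz
  rcases hz with rfl | rfl
  exacts [absurd rfl hza, hT.2]

section Finite

variable [Finite L]

/-- A cover lying between two others is below their join. -/
theorem le_sup_of_covBy {a c d e : L} (hc : a ⋖ c) (hd : a ⋖ d) (he : a ⋖ e)
    (hcd : D.inclination a c < D.inclination a d) (hde : D.inclination a d < D.inclination a e) :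
    d ≤ c ⊔ e := by
  by_contra hle
  have hcM : c ≤ c ⊔ e := le_sup_left
  have heM : e ≤ c ⊔ e := le_sup_right
  have haM : a < c ⊔ e := hc.lt.trans_le hcM
  have hdM : d ≤ d ⊔ (c ⊔ e) := le_sup_left
  obtain ⟨C, hC, hcC⟩ := IsMaxChainIn.exists_mem hc.le hcM
  obtain ⟨C', hC', heC⟩ := IsMaxChainIn.exists_mem he.le heM
  obtain ⟨K, hK, hdK⟩ := IsMaxChainIn.exists_mem hd.le hdM
  obtain ⟨f, hf⟩ := D.exists_isChainGraph haM.le hC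
  obtain ⟨g, hg⟩ := D.exists_isChainGraph haM.le hC'
  obtain ⟨k, hk⟩ := D.exists_isChainGraph (hd.le.trans hdM) hK
  -- All elements of `K` other than `a` are above `d`, so `K` meets neither side chain above `a`. At
  -- the height of `c ⊔ e` it would have to pass strictly between two curves that meet there.
  have hbelow : ∀ z ∈ K, z ≤ c ⊔ e → z = a := fun z hz hzM => by
    by_contra hza
    rcases hK.le_total hz hdK with h | h
    · exact hle (((hd.eq_or_eq (hK.bot_le hz) h).resolve_left hza).ge.trans hzM)
    · exact hle (h.trans hzM)
  have hT := D.height_lt haM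
  have hTK : (D.pos (c ⊔ e)).2 ≤ (D.pos (d ⊔ (c ⊔ e))).2 := D.height_le le_sup_right
  have h1 := (hf.lt_iff_inclination_lt hk hC hK hcC hdK hc hd (fun h => hcd.ne (h ▸ rfl)) hT le_rfl
    hTK fun z hz hza => absurd (hbelow z hz.2 (hC.le_top hz.1)) hza).2 hcd
  have h2 := (hk.lt_iff_inclination_lt hg hK hC' hdK heC hd he (fun h => hde.ne (h ▸ rfl)) hT hTK
    le_rfl fun z hz hza => absurd (hbelow z hz.1 (hC'.le_top hz.2)) hza).2 hde
  rw [hf.vertex _ (hC.top_mem haM.le)] at h1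
  rw [hg.vertex _ (hC'.top_mem haM.le)] at h2
  exact h1.not_gt h2

/-- A lower cover lying between two others is above their meet. -/
theorem inf_le_of_covBy {b c d e : L} (hc : c ⋖ b) (hd : d ⋖ b) (he : e ⋖ b)
    (hcd : D.inclination c b < D.inclination d b) (hde : D.inclination d b < D.inclination e b) :
    c ⊓ e ≤ d := by
  by_contra hle
  have hcM : c ⊓ e ≤ c := inf_le_left
  have heM : c ⊓ e ≤ e := inf_le_right
  have haM : c ⊓ e < b := hcM.trans_lt hc.lt
  have hdM : d ⊓ (c ⊓ e) ≤ d := inf_le_left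
  obtain ⟨C, hC, hcC⟩ := IsMaxChainIn.exists_mem hcM hc.le
  obtain ⟨C', hC', heC⟩ := IsMaxChainIn.exists_mem heM he.le
  obtain ⟨K, hK, hdK⟩ := IsMaxChainIn.exists_mem hdM hd.le
  obtain ⟨f, hf⟩ := D.exists_isChainGraph haM.le hC
  obtain ⟨g, hg⟩ := D.exists_isChainGraph haM.le hC'
  obtain ⟨k, hk⟩ := D.exists_isChainGraph (hdM.trans hd.le) hK
  have habove : ∀ z ∈ K, c ⊓ e ≤ z → z = b := fun z hz hzM => by
    by_contra hza
    rcases hK.le_total hz hdK with h | h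
    · exact hle (hzM.trans h)
    · exact hle (hzM.trans ((hd.eq_or_eq h (hK.le_top hz)).resolve_right hza).le)
  have hT := D.height_lt haM
  have hTK : (D.pos (d ⊓ (c ⊓ e))).2 ≤ (D.pos (c ⊓ e)).2 := D.height_le inf_le_right
  have h1 := (hk.lt_iff_inclination_gt hf hK hC hdK hcC hd hc (fun h => hcd.ne (h ▸ rfl)) hT hTK
    le_rfl fun z hz hzb => absurd (habove z hz.1 (hC.bot_le hz.2)) hzb).2 hcd
  have h2 := (hg.lt_iff_inclination_gt hk hC' hK heC hdK he hd (fun h => hde.ne (h ▸ rfl)) hT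
    le_rfl hTK fun z hz hzb => absurd (habove z hz.2 (hC'.bot_le hz.1)) hzb).2 hde
  rw [hf.vertex _ (hC.bot_mem haM.le)] at h1
  rw [hg.vertex _ (hC'.bot_mem haM.le)] at h2
  exact h1.not_gt h2

/-! ### Regions and 4-cells. -/

/-- The boundary chains of a region belong to it. -/
theorem onLeft_of_mem {a b : L} {C₁ C₂ : Set L} (hab : a < b) (hnab : ¬ a ⋖ b)
    (h₁ : IsMaxChainIn a b C₁) (h₂ : IsMaxChainIn a b C₂) (hinter : C₁ ∩ C₂ = {a, b})
    (hright : ∀ z ∈ C₂ \ {a, b}, D.OnRight C₁ z) {z : L} (hz : z ∈ C₁) : D.OnLeft C₂ z := by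
  obtain ⟨f, hf⟩ := D.exists_isChainGraph hab.le h₁
  obtain ⟨g, hg⟩ := D.exists_isChainGraph hab.le h₂
  obtain ⟨v, hv, hav⟩ := h₁.exists_covBy_mem hab
  obtain ⟨v', hv', hav'⟩ := h₂.exists_covBy_mem hab
  have hb : ∀ w, a ⋖ w → w ≠ b := fun w hw h => hnab (h ▸ hw)
  have hne : v ≠ v' := fun h => by
    have hmem : v ∈ C₁ ∩ C₂ := ⟨hv, h ▸ hv'⟩
    rw [hinter] at hmem
    exact hmem.elim hav.ne' (hb v hav)
  have hiff := fun T => hf.lt_of_inter_eq hg h₁ h₂ hinter hv hv' hav hav' hne (T := T)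
  have hv'b : v' < b := lt_of_le_of_ne (h₂.le_top hv') (hb v' hav')
  -- The hypothesis only places vertices of `C₂` relative to `C₁`. The single vertex `v'`, distinct
  -- from `b` because `[a, b]` is not an edge, decides the order at all inner heights.
  have hfg : D.inclination a v < D.inclination a v' := by
    refine lt_of_le_of_ne (not_lt.1 fun h => ?_) fun h => hne (D.inclination_left_injOn a hav hav' h)
    have h3 := (hg.lt_of_inter_eq hf h₂ h₁ (by rw [Set.inter_comm, hinter]) hv' hv hav' hav hne.symm
      ⟨D.height_lt hav'.lt, D.height_lt hv'b⟩).2 h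
    have h4 := (hf.onRight_iff hab ⟨hav'.le, hv'b.le⟩).1
      (hright v' ⟨hv', by rintro (h | h); exacts [hav'.ne' h, hv'b.ne h]⟩)
    rw [hg.vertex v' hv'] at h3
    exact h3.not_ge h4
  rw [hg.onLeft_iff hab (h₁.1.1 hz), ← hf.vertex z hz]
  rcases (h₁.bot_le hz).eq_or_lt with rfl | h1
  · rw [hf.vertex a hz, hg.vertex a (h₂.bot_mem hab.le)]
  rcases (h₁.le_top hz).eq_or_lt with rfl | h2
  · rw [hf.vertex z hz, hg.vertex z (h₂.top_mem hab.le)]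
  · exact ((hiff _ ⟨D.height_lt h1, D.height_lt h2⟩).2 hfg).le

/-- A region contains `a < b` and its two boundary chains. -/
theorem IsRegion.exists_chains {D : PlanarDiagram L} {R : Set L} (hR : D.IsRegion R) :
    ∃ (a b c d : L) (C₁ C₂ : Set L), IsMaxChainIn a b C₁ ∧ IsMaxChainIn a b C₂ ∧
      C₁ ⊆ R ∧ C₂ ⊆ R ∧ C₁ ∩ C₂ = {a, b} ∧ c ∈ C₁ ∧ d ∈ C₂ ∧ c ≠ d ∧
      a < c ∧ c < b ∧ a < d ∧ d < b := by
  obtain ⟨a, b, C₁, C₂, hab, hnab, h₁, h₂, hinter, hright, rfl⟩ := hR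
  obtain ⟨c, hc, hac⟩ := h₁.exists_covBy_mem hab
  obtain ⟨d, hd, had⟩ := h₂.exists_covBy_mem hab
  have hb : ∀ w, a ⋖ w → w ≠ b := fun w hw h => hnab (h ▸ hw)
  obtain ⟨f, hf⟩ := D.exists_isChainGraph hab.le h₁
  obtain ⟨g, hg⟩ := D.exists_isChainGraph hab.le h₂
  refine ⟨a, b, c, d, C₁, C₂, h₁, h₂, fun z hz => ⟨h₁.1.1 hz, ?_,
    D.onLeft_of_mem hab hnab h₁ h₂ hinter hright hz⟩, fun z hz => ⟨h₂.1.1 hz, ?_, ?_⟩, hinter, hc,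
    hd, ?_, hac.lt, lt_of_le_of_ne (h₁.le_top hc) (hb c hac), had.lt,
    lt_of_le_of_ne (h₂.le_top hd) (hb d had)⟩
  · exact (hf.onRight_iff hab (h₁.1.1 hz)).2 (hf.vertex z hz).le
  · by_cases hzab : z ∈ ({a, b} : Set L)
    · rw [← hinter] at hzab
      exact (hf.onRight_iff hab (h₁.1.1 hzab.1)).2 (hf.vertex z hzab.1).le
    · exact hright z ⟨hz, hzab⟩
  · exact (hg.onLeft_iff hab (h₂.1.1 hz)).2 (hg.vertex z hz).ge
  · rintro rfl
    have hmem : c ∈ C₁ ∩ C₂ := ⟨hc, hd⟩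
    rw [hinter] at hmem
    exact hmem.elim hac.ne' (hb c hac)

theorem ncard_four {a b c d : L} (hcd : c ≠ d) (hac : a < c) (hcb : c < b) (had : a < d)
    (hdb : d < b) : ({a, c, d, b} : Set L).ncard = 4 := by
  rw [Set.ncard_insert_of_notMem, Set.ncard_insert_of_notMem, Set.ncard_pair hdb.ne]
  · rintro (h | h)
    exacts [hcd h, hcb.ne h]
  · rintro (h | h | h)
    exacts [hac.ne h, had.ne h, (hac.trans hcb).ne h]

theorem IsRegion.four_le_ncard {D : PlanarDiagram L} {R : Set L} (hR : D.IsRegion R) :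
    4 ≤ R.ncard := by
  obtain ⟨a, b, c, d, C₁, C₂, h₁, h₂, hs₁, hs₂, -, hc, hd, hcd, hac, hcb, had, hdb⟩ :=
    hR.exists_chains
  rw [← ncard_four hcd hac hcb had hdb]
  refine Set.ncard_le_ncard ?_ (Set.toFinite R)
  rintro z (rfl | rfl | rfl | rfl)
  exacts [hs₁ (h₁.bot_mem (hac.trans hcb).le), hs₁ hc, hs₂ hd, hs₁ (h₁.top_mem (hac.trans hcb).le)]

theorem IsFourCell.exists_eq {D : PlanarDiagram L} {S : Set L} (hS : D.IsFourCell S) :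
    ∃ a b c d : L, S = {a, c, d, b} ∧ c ≠ d ∧ a ⋖ c ∧ c ⋖ b ∧ a ⋖ d ∧ d ⋖ b := by
  obtain ⟨a, b, c, d, C₁, C₂, h₁, h₂, hs₁, hs₂, hinter, hc, hd, hcd, hac, hcb, had, hdb⟩ :=
    hS.1.1.exists_chains
  have hab := (hac.trans hcb).le
  have hS' : {a, c, d, b} = S := by
    refine Set.eq_of_subset_of_ncard_le ?_ (by rw [ncard_four hcd hac hcb had hdb, hS.2])
      (Set.toFinite S)
    rintro z (rfl | rfl | rfl | rfl)
    exacts [hs₁ (h₁.bot_mem hab), hs₁ hc, hs₂ hd, hs₁ (h₁.top_mem hab)]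
  -- A boundary chain inside the four elements avoids the inner element of the other one, so it is
  -- `{a, x, b}`, and its maximality gives the two coverings.
  have key : ∀ {C C' : Set L} {x y : L}, IsMaxChainIn a b C → C ⊆ {a, x, y, b} → C ∩ C' = {a, b} →
      y ∈ C' → x ∈ C → a < x → x < b → a < y → y < b → a ⋖ x ∧ x ⋖ b := by
    intro C C' x y hC hsub hi hy hx hax hxb hay hyb
    have hC3 : ∀ z ∈ C, z = a ∨ z = x ∨ z = b := by
      intro z hz
      rcases hsub hz with rfl | rfl | rfl | rfl
      · exact .inl rfl
      · exact .inr (.inl rfl)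
      · have hmem : z ∈ C ∩ C' := ⟨hz, hy⟩
        rw [hi] at hmem
        exact (hmem.elim hay.ne' hyb.ne).elim
      · exact .inr (.inr rfl)
    refine ⟨⟨hax, fun w h1 h2 => ?_⟩, ⟨hxb, fun w h1 h2 => ?_⟩⟩
    · have hw : w ∈ C := hC.mem_of_comparable ⟨h1.le, (h2.trans hxb).le⟩ fun z hz => by
        rcases hC3 z hz with rfl | rfl | rfl
        exacts [.inr h1.le, .inl h2.le, .inl (h2.trans hxb).le]
      rcases hC3 w hw with rfl | rfl | rfl
      exacts [lt_irrefl _ h1, lt_irrefl _ h2, (h2.trans hxb).false]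
    · have hw : w ∈ C := hC.mem_of_comparable ⟨(hax.trans h1).le, h2.le⟩ fun z hz => by
        rcases hC3 z hz with rfl | rfl | rfl
        exacts [.inr (hax.trans h1).le, .inr h1.le, .inl h2.le]
      rcases hC3 w hw with rfl | rfl | rfl
      exacts [(hax.trans h1).false, lt_irrefl _ h1, lt_irrefl _ h2]
  obtain ⟨k1, k2⟩ := key h₁ (hS' ▸ hs₁) hinter hd hc hac hcb had hdb
  obtain ⟨k3, k4⟩ := key h₂ (by rw [Set.insert_comm d c, hS']; exact hs₂)
    (by rw [Set.inter_comm, hinter]) hc hd had hdb hac hcb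
  exact ⟨a, b, c, d, hS'.symm, hcd, k1, k2, k3, k4⟩

/-- A diamond-shaped quadruple with nothing inside is a 4-cell. -/
theorem isFourCell_of_forall {a b y z : L} {f g : ℝ → ℝ} (hay : a ⋖ y) (hyb : y ⋖ b) (haz : a ⋖ z)
    (hzb : z ⋖ b) (hyz : D.inclination a y < D.inclination a z)
    (hf : D.IsChainGraph a b {a, y, b} f) (hg : D.IsChainGraph a b {a, z, b} g)
    (hempty : ∀ w, a < w → w < b → w ≠ y → w ≠ z → f (D.pos w).2 ≤ (D.pos w).1 →
      (D.pos w).1 ≤ g (D.pos w).2 → False) :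
    D.IsFourCell {a, y, z, b} := by
  have hne : y ≠ z := fun h => hyz.ne (h ▸ rfl)
  have hab := hay.lt.trans hyb.lt
  have hnab : ¬ a ⋖ b := fun h => h.2 hay.lt hyb.lt
  have h₁ := IsMaxChainIn.of_covBy_covBy hay hyb
  have h₂ := IsMaxChainIn.of_covBy_covBy haz hzb
  have hinter : ({a, y, b} : Set L) ∩ {a, z, b} = {a, b} := by
    ext w
    constructor
    · rintro ⟨rfl | rfl | rfl, h⟩
      · exact .inl rfl
      · exact (h.elim hay.ne' fun h => h.elim hne hyb.ne).elim
      · exact .inr rfl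
    · rintro (rfl | rfl)
      exacts [⟨.inl rfl, .inl rfl⟩, ⟨.inr (.inr rfl), .inr (.inr rfl)⟩]
  have hright : ∀ w ∈ ({a, z, b} : Set L) \ {a, b}, D.OnRight {a, y, b} w := by
    rintro w ⟨rfl | rfl | rfl, hw⟩
    · exact (hw (.inl rfl)).elim
    · have h3 := (hf.lt_of_inter_eq hg h₁ h₂ hinter (.inr (.inl rfl)) (.inr (.inl rfl)) hay haz hne
        ⟨D.height_lt haz.lt, D.height_lt hzb.lt⟩).2 hyz
      rw [hg.vertex w (.inr (.inl rfl))] at h3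
      exact (hf.onRight_iff hab ⟨haz.le, hzb.le⟩).2 h3.le
    · exact (hw (.inr rfl)).elim
  have hreg : D.IsRegion {a, y, z, b} := by
    refine ⟨a, b, _, _, hab, hnab, h₁, h₂, hinter, hright, ?_⟩
    ext w
    constructor
    · have hl := fun w hw => D.onLeft_of_mem hab hnab h₁ h₂ hinter hright (z := w) hw
      have hr₁ : ∀ w ∈ ({a, y, b} : Set L), D.OnRight {a, y, b} w := fun w hw =>
        (hf.onRight_iff hab (h₁.1.1 hw)).2 (hf.vertex w hw).le
      rintro (rfl | rfl | rfl | rfl)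
      · exact ⟨⟨le_rfl, hab.le⟩, hr₁ _ (.inl rfl), hl _ (.inl rfl)⟩
      · exact ⟨⟨hay.le, hyb.le⟩, hr₁ _ (.inr (.inl rfl)), hl _ (.inr (.inl rfl))⟩
      · refine ⟨⟨haz.le, hzb.le⟩, hright _ ⟨.inr (.inl rfl), ?_⟩,
          (hg.onLeft_iff hab ⟨haz.le, hzb.le⟩).2 (hg.vertex _ (.inr (.inl rfl))).ge⟩
        rintro (h | h)
        exacts [haz.ne' h, hzb.ne h]
      · exact ⟨⟨hab.le, le_rfl⟩, hr₁ _ (.inr (.inr rfl)), hl _ (.inr (.inr rfl))⟩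
    · rintro ⟨hw, hr, hl⟩
      by_contra hmem
      simp only [Set.mem_insert_iff, Set.mem_singleton_iff, not_or] at hmem
      exact hempty w (lt_of_le_of_ne hw.1 (Ne.symm hmem.1)) (lt_of_le_of_ne hw.2 hmem.2.2.2)
        hmem.2.1 hmem.2.2.1 ((hf.onRight_iff hab hw).1 hr) ((hg.onLeft_iff hab hw).1 hl)
  have hcard := ncard_four hne hay.lt hyb.lt haz.lt hzb.lt
  -- Every region has at least four elements, so one with exactly four is minimal.
  exact ⟨⟨hreg, fun R' hR' hle =>
    (Set.eq_of_subset_of_ncard_le hle (hcard ▸ hR'.four_le_ncard) (Set.toFinite _)).ge⟩, hcard⟩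

/-- Two covers of `a` with a common cover and with no cover of `a` between them span a 4-cell. -/
theorem isFourCell_of_adjacent_covers {a b y z : L} (hay : a ⋖ y) (hyb : y ⋖ b) (haz : a ⋖ z)
    (hzb : z ⋖ b) (hyz : D.inclination a y < D.inclination a z)
    (hadj : ∀ w, a ⋖ w → D.inclination a y < D.inclination a w →
      ¬ D.inclination a w < D.inclination a z) : D.IsFourCell {a, y, z, b} := by
  have hab := hay.lt.trans hyb.lt
  have h₁ := IsMaxChainIn.of_covBy_covBy hay hyb
  have h₂ := IsMaxChainIn.of_covBy_covBy haz hzb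
  obtain ⟨f, hf⟩ := D.exists_isChainGraph hab.le h₁
  obtain ⟨g, hg⟩ := D.exists_isChainGraph hab.le h₂
  refine D.isFourCell_of_forall hay hyb haz hzb hyz hf hg fun w haw hwb hwy hwz hfw hgw => ?_
  -- A chain from `a` through `v` to `w` avoids `y` and `z`. As `w` is enclosed by the two sides,
  -- `v` would be a cover between `y` and `z`.
  obtain ⟨v, hav, hvw⟩ := exists_covBy_le_of_lt haw
  obtain ⟨K, hK, hvK⟩ := IsMaxChainIn.exists_mem hav.le hvw
  obtain ⟨k, hk⟩ := D.exists_isChainGraph haw.le hK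
  have hkw : k (D.pos w).2 = (D.pos w).1 := hk.vertex w (hK.top_mem haw.le)
  have hsep : ∀ {x : L}, x ⋖ b → w ≠ x → ¬ x ≤ w := fun {x} hx hwx h =>
    (hx.eq_or_eq h hwb.le).elim hwx hwb.ne
  have hcom : ∀ {x : L}, x ⋖ b → w ≠ x → ∀ u ∈ ({a, x, b} : Set L), u ∈ K → u = a := by
    rintro x hx hwx u (rfl | rfl | rfl) hu
    exacts [rfl, (hsep hx hwx (hK.le_top hu)).elim, (hwb.not_ge (hK.le_top hu)).elim]
  have hvy : y ≠ v := fun h => hsep hyb hwy (h.trans_le hvw)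
  have hvz : z ≠ v := fun h => hsep hzb hwz (h.trans_le hvw)
  have hT := D.height_lt haw
  have hTb := D.height_le hwb.le
  refine hadj v hav (lt_of_le_of_ne (not_lt.1 fun h => ?_)
    fun h => hvy (D.inclination_left_injOn a hay hav h))
    (lt_of_le_of_ne (not_lt.1 fun h => ?_) fun h => hvz (D.inclination_left_injOn a hav haz h).symm)
  · refine ((hk.lt_iff_inclination_lt hf hK h₁ hvK (.inr (.inl rfl)) hav hay hvy.symm hT le_rfl hTb
      fun u hu hua => absurd (hcom hyb hwy u hu.2 hu.1) hua).2 h).not_ge (hkw ▸ hfw)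
  · refine ((hg.lt_iff_inclination_lt hk h₂ hK (.inr (.inl rfl)) hvK haz hav hvz hT hTb le_rfl
      fun u hu hua => absurd (hcom hzb hwz u hu.1 hu.2) hua).2 h).not_ge (hkw ▸ hgw)

/-- Two lower covers of `b` that cover a common element and have no lower cover of `b` between them
span a 4-cell. -/
theorem isFourCell_of_adjacent_lower_covers {a b y z : L} (hay : a ⋖ y) (hyb : y ⋖ b) (haz : a ⋖ z)
    (hzb : z ⋖ b) (hyz : D.inclination z b < D.inclination y b)
    (hadj : ∀ w, w ⋖ b → D.inclination z b < D.inclination w b →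
      ¬ D.inclination w b < D.inclination y b) : D.IsFourCell {a, y, z, b} := by
  have hab := hay.lt.trans hyb.lt
  have hne : y ≠ z := fun h => hyz.ne (h ▸ rfl)
  have h₁ := IsMaxChainIn.of_covBy_covBy hay hyb
  have h₂ := IsMaxChainIn.of_covBy_covBy haz hzb
  obtain ⟨f, hf⟩ := D.exists_isChainGraph hab.le h₁
  obtain ⟨g, hg⟩ := D.exists_isChainGraph hab.le h₂
  have hinter : ∀ u ∈ ({a, y, b} : Set L) ∩ {a, z, b}, u = a ∨ u = b := by
    rintro u ⟨rfl | rfl | rfl, h⟩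
    exacts [.inl rfl, (h.elim hay.ne' fun h => h.elim hne hyb.ne).elim, .inr rfl]
  -- The order of the edges at `b` is carried to the height of `y` and from there to `a`, where
  -- `isFourCell_of_forall` needs it.
  have hfg : f (D.pos y).2 < g (D.pos y).2 :=
    (hf.lt_iff_inclination_gt hg h₁ h₂ (.inr (.inl rfl)) (.inr (.inl rfl)) hyb hzb hne
      (D.height_lt hyb.lt) (D.height_le hay.le) (D.height_le hay.le)
      fun u hu hub => by
        rw [(hinter u hu).resolve_right hub]
        exact D.height_lt hay.lt).2 hyz
  have hayz : D.inclination a y < D.inclination a z :=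
    (hf.lt_iff_inclination_lt hg h₁ h₂ (.inr (.inl rfl)) (.inr (.inl rfl)) hay haz hne
      (D.height_lt hay.lt) (D.height_le hyb.le) (D.height_le hyb.le)
      fun u hu hua => by
        rw [(hinter u hu).resolve_left hua]
        exact D.height_lt hyb.lt).1 hfg
  refine D.isFourCell_of_forall hay hyb haz hzb hayz hf hg fun w haw hwb hwy hwz hfw hgw => ?_
  obtain ⟨v, hwv, hvb⟩ := exists_le_covBy_of_lt hwb
  obtain ⟨K, hK, hvK⟩ := IsMaxChainIn.exists_mem hwv hvb.le
  obtain ⟨k, hk⟩ := D.exists_isChainGraph hwb.le hK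
  have hkw : k (D.pos w).2 = (D.pos w).1 := hk.vertex w (hK.bot_mem hwb.le)
  have hsep : ∀ {x : L}, a ⋖ x → w ≠ x → ¬ w ≤ x := fun {x} hx hwx h =>
    (hx.eq_or_eq haw.le h).elim haw.ne' hwx
  have hcom : ∀ {x : L}, a ⋖ x → w ≠ x → ∀ u ∈ ({a, x, b} : Set L), u ∈ K → u = b := by
    rintro x hx hwx u (rfl | rfl | rfl) hu
    exacts [(haw.not_ge (hK.bot_le hu)).elim, (hsep hx hwx (hK.bot_le hu)).elim, rfl]
  have hvy : y ≠ v := fun h => hsep hay hwy (hwv.trans_eq h.symm)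
  have hvz : z ≠ v := fun h => hsep haz hwz (hwv.trans_eq h.symm)
  have hT := D.height_lt hwb
  have hTa := D.height_le haw.le
  refine hadj v hvb (lt_of_le_of_ne (not_lt.1 fun h => ?_)
    fun h => hvz (D.inclination_right_injOn b hzb hvb h))
    (lt_of_le_of_ne (not_lt.1 fun h => ?_)
      fun h => hvy (D.inclination_right_injOn b hvb hyb h).symm)
  · refine ((hg.lt_iff_inclination_gt hk h₂ hK (.inr (.inl rfl)) hvK hzb hvb hvz hT hTa le_rfl
      fun u hu hua => absurd (hcom haz hwz u hu.1 hu.2) hua).2 h).not_ge (hkw ▸ hgw)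
  · refine ((hk.lt_iff_inclination_gt hf hK h₁ hvK (.inr (.inl rfl)) hvb hyb hvy.symm hT le_rfl hTa
      fun u hu hua => absurd (hcom hay hwy u hu.2 hu.1) hua).2 h).not_ge (hkw ▸ hfw)

end Finite

end PlanarDiagram

/-! ### Pairs of covers and induction on betweenness. -/

theorem CovBy.inf_eq_of_ne {L : Type*} [Lattice L] {x y z : L} (hy : x ⋖ y) (hz : x ⋖ z)
    (hne : y ≠ z) : y ⊓ z = x :=
  (hy.eq_or_eq (le_inf hy.le hz.le) inf_le_left).resolve_right fun h =>
    ((hz.eq_or_eq hy.le (inf_eq_left.1 h)).elim hy.ne' hne)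

theorem CovBy.sup_eq_of_ne {L : Type*} [Lattice L] {x y z : L} (hy : y ⋖ x) (hz : z ⋖ x)
    (hne : y ≠ z) : y ⊔ z = x :=
  (hy.eq_or_eq le_sup_left (sup_le hy.le hz.le)).resolve_left fun h =>
    ((hz.eq_or_eq (sup_eq_left.1 h) hy.le).elim hne hy.ne)

/-- `w` lies strictly between `y` and `z` when measured by `φ`. -/
def StrictlyBetween {α : Type*} (φ : α → ℝ) (y w z : α) : Prop :=
  (φ y < φ w ∧ φ w < φ z) ∨ (φ z < φ w ∧ φ w < φ y)

/-- Strong induction on the number of elements of `S` strictly between `y` and `z`: splitting at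
such a `w` leaves fewer on either side, since `w` itself no longer counts. -/
theorem strictlyBetween_induction {α : Type*} [Finite α] (φ : α → ℝ) {S : Set α}
    {T : α → α → Prop}
    (adj : ∀ y ∈ S, ∀ z ∈ S, y ≠ z → (∀ w ∈ S, ¬ StrictlyBetween φ y w z) → T y z)
    (trans : ∀ y ∈ S, ∀ w ∈ S, ∀ z ∈ S, StrictlyBetween φ y w z → T y w → T w z → T y z)
    {y z : α} (hy : y ∈ S) (hz : z ∈ S) (hne : y ≠ z) : T y z := by
  induction hn : {w ∈ S | StrictlyBetween φ y w z}.ncard using Nat.strong_induction_on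
    generalizing y z with
  | _ n ih =>
  by_cases h : ∃ w ∈ S, StrictlyBetween φ y w z
  · obtain ⟨w, hw, hb⟩ := h
    have key : ∀ y' z' : α, (∀ v, StrictlyBetween φ y' v z' → StrictlyBetween φ y v z) →
        ¬ StrictlyBetween φ y' w z' → {v ∈ S | StrictlyBetween φ y' v z'}.ncard < n := by
      intro y' z' h1 h2
      have hsub : {v ∈ S | StrictlyBetween φ y' v z'} ⊆ {v ∈ S | StrictlyBetween φ y v z} :=
        fun v hv => ⟨hv.1, h1 v hv.2⟩
      rw [← hn]
      exact Set.ncard_lt_ncard ((Set.ssubset_iff_of_subset hsub).2 ⟨w, ⟨hw, hb⟩, fun h => h2 h.2⟩)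
        (Set.toFinite _)
    unfold StrictlyBetween at *
    refine trans y hy w hw z hz hb (ih _ (key y w ?_ ?_) hy hw ?_ rfl)
      (ih _ (key w z ?_ ?_) hw hz ?_ rfl)
    · intro v hv
      rcases hb with hb | hb <;> rcases hv with hv | hv
      exacts [.inl ⟨hv.1, hv.2.trans hb.2⟩, absurd (hv.1.trans hv.2) hb.1.not_gt,
        absurd (hv.1.trans hv.2) hb.2.not_gt, .inr ⟨hb.1.trans hv.1, hv.2⟩]
    · rintro (h | h)
      exacts [h.2.false, h.1.false]
    · rintro rfl
      rcases hb with h | h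
      exacts [h.1.false, h.2.false]
    · intro v hv
      rcases hb with hb | hb <;> rcases hv with hv | hv
      exacts [.inl ⟨hb.1.trans hv.1, hv.2⟩, absurd (hv.1.trans hv.2) hb.2.not_gt,
        absurd (hv.1.trans hv.2) hb.1.not_gt, .inr ⟨hv.1, hv.2.trans hb.2⟩]
    · rintro (h | h)
      exacts [h.1.false, h.2.false]
    · rintro rfl
      rcases hb with h | h
      exacts [h.2.false, h.1.false]
  · exact adj y hy z hz hne fun w hw hb => h ⟨w, hw, hb⟩

/-! ### SL-steps and inner covers. -/

namespace PlanarDiagram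

variable {L : Type*} [Lattice L] (D : PlanarDiagram L)

/-- One step of an SL-sequence. -/
def SLStep (r s : PrimeInterval L) : Prop :=
  D.CellPerspective r s ∨ D.SwingsTo r s ∨ D.TiltsTo r s

theorem three_le_encard {α : Type*} {S : Set α} {φ : α → ℝ} {c d e : α} (hc : c ∈ S) (hd : d ∈ S)
    (he : e ∈ S) (hcd : φ c < φ d) (hde : φ d < φ e) : 3 ≤ S.encard := by
  have h3 : ({c, d, e} : Set α).encard = 3 := Set.encard_eq_three.2 ⟨c, d, e,
    fun h => hcd.ne (h ▸ rfl), fun h => (hcd.trans hde).ne (h ▸ rfl), fun h => hde.ne (h ▸ rfl), rfl⟩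
  rw [← h3]
  refine Set.encard_le_encard ?_
  rintro z (rfl | rfl | rfl) <;> assumption

/-- A cover that is neither the leftmost nor the rightmost one. -/
def IsInnerCover (a b : L) : Prop := ¬ D.IsLeftmostCover a b ∧ ¬ D.IsRightmostCover a b

/-- A lower cover that is neither the leftmost nor the rightmost one. -/
def IsInnerLowerCover (a b : L) : Prop :=
  ¬ D.IsLeftmostLowerCover a b ∧ ¬ D.IsRightmostLowerCover a b

variable {D}

theorem IsInnerCover.exists_lt_lt {a b : L} (h : D.IsInnerCover a b) (hab : a ⋖ b) :
    ∃ c e, a ⋖ c ∧ a ⋖ e ∧ D.inclination a c < D.inclination a b ∧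
      D.inclination a b < D.inclination a e := by
  obtain ⟨h1, h2⟩ := h
  simp only [IsLeftmostCover, IsRightmostCover, not_and, not_forall, not_le] at h1 h2
  obtain ⟨c, hc, hcb⟩ := h1 hab
  obtain ⟨e, he, hbe⟩ := h2 hab
  exact ⟨c, e, hc, he, hcb, hbe⟩

theorem IsInnerLowerCover.exists_lt_lt {a b : L} (h : D.IsInnerLowerCover a b) (hab : a ⋖ b) :
    ∃ c e, c ⋖ b ∧ e ⋖ b ∧ D.inclination c b < D.inclination a b ∧
      D.inclination a b < D.inclination e b := by
  obtain ⟨h1, h2⟩ := h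
  simp only [IsLeftmostLowerCover, IsRightmostLowerCover, not_and, not_forall, not_le] at h1 h2
  obtain ⟨e, he, hbe⟩ := h1 hab
  obtain ⟨c, hc, hcb⟩ := h2 hab
  exact ⟨c, e, hc, he, hcb, hbe⟩

theorem isInnerCover_of_strictlyBetween {a y w z : L} (hy : a ⋖ y) (hz : a ⋖ z)
    (h : StrictlyBetween (D.inclination a) y w z) : D.IsInnerCover a w := by
  constructor <;> rintro ⟨-, hext⟩ <;> rcases h with h | h
  exacts [h.1.not_ge (hext y hy), h.1.not_ge (hext z hz), h.2.not_ge (hext z hz),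
    h.2.not_ge (hext y hy)]

theorem isInnerLowerCover_of_strictlyBetween {b y w z : L} (hy : y ⋖ b) (hz : z ⋖ b)
    (h : StrictlyBetween (D.inclination · b) y w z) : D.IsInnerLowerCover w b := by
  constructor <;> rintro ⟨-, hext⟩ <;> rcases h with h | h
  exacts [h.2.not_ge (hext z hz), h.2.not_ge (hext y hy), h.1.not_ge (hext y hy),
    h.1.not_ge (hext z hz)]

/-- Meet with `e`, then join with `v`: the pair `(u, x)` becomes `(v, e ⊔ v)`, and `e ⊔ v = x`. This
is the algebra behind a swing; `con_of_le_sup` is its dual for a tilt. -/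
theorem con_of_inf_le {c : LatticeCon L} {u v e x : L} (hv : v ⋖ x) (he : e ⋖ x) (hne : v ≠ e)
    (hle : u ⊓ e ≤ v) (h : c.r u x) : c.r v x := by
  have h1 := c.sup (c.inf h (c.iseqv.refl e)) (c.iseqv.refl v)
  rwa [sup_eq_right.2 hle, inf_eq_right.2 he.le, sup_comm, hv.sup_eq_of_ne he hne] at h1

theorem con_of_le_sup {c : LatticeCon L} {u v e x : L} (hv : x ⋖ v) (he : x ⋖ e) (hne : v ≠ e)
    (hle : v ≤ u ⊔ e) (h : c.r x u) : c.r x v := by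
  have h1 := c.inf (c.sup h (c.iseqv.refl e)) (c.iseqv.refl v)
  rwa [inf_eq_right.2 hle, sup_eq_right.2 he.le, inf_comm, hv.inf_eq_of_ne he hne] at h1

/-! ### The edges that can be reached from `p` -/

variable {p : PrimeInterval L}

variable (D) in
/-- The edge from `u` to `v` is the end of an SL-sequence that starts at `p`. -/
def Reaches (p : PrimeInterval L) (u v : L) : Prop :=
  ∃ h : u ⋖ v, Relation.ReflTransGen D.SLStep p ⟨u, v, h⟩

variable (D) in
/-- The interval `[u, v]` contains a maximal chain all of whose edges can be reached from `p`. -/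
def ReachesChain (p : PrimeInterval L) : L → L → Prop := Relation.ReflTransGen (D.Reaches p)

theorem ReachesChain.le {u v : L} (h : D.ReachesChain p u v) : u ≤ v := by
  induction h with
  | refl => exact le_rfl
  | tail _ h ih => exact ih.trans h.1.le

theorem ReachesChain.reaches {u v : L} (h : D.ReachesChain p u v) (huv : u ⋖ v) :
    D.Reaches p u v := by
  rcases Relation.ReflTransGen.cases_head h with rfl | ⟨w, hw, hwv⟩
  · exact absurd rfl huv.ne
  · rwa [(huv.eq_or_eq hw.1.le (ReachesChain.le hwv)).resolve_left hw.1.ne'] at hw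

/-- Here `ih` is `Reaches.inf_of_le` for all tops below `x`. Inside the induction on `x`, this
extends it from single edges to chains. -/
theorem ReachesChain.inf_of_forall {x : L}
    (ih : ∀ x' < x, ∀ u w : L, D.Reaches p u x' → w ≤ x' → D.ReachesChain p (u ⊓ w) w)
    {u v : L} (h : D.ReachesChain p u v) (hv : v < x) (w : L) :
    D.ReachesChain p (u ⊓ w) (v ⊓ w) := by
  induction h with
  | refl => exact .refl
  | @tail s t _ h ih' =>
    have h1 := ih t hv s (t ⊓ w) h inf_le_left
    rw [← inf_assoc, inf_eq_left.2 h.1.le] at h1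
    exact (ih' (h.1.lt.trans hv)).trans h1

/-! ### Consequences of planarity -/

variable [Finite L]

theorem le_sup_of_strictlyBetween {a y w z : L} (hy : a ⋖ y) (hw : a ⋖ w) (hz : a ⋖ z)
    (h : StrictlyBetween (D.inclination a) y w z) : w ≤ y ⊔ z := by
  rcases h with h | h
  · exact D.le_sup_of_covBy hy hw hz h.1 h.2
  · exact sup_comm y z ▸ D.le_sup_of_covBy hz hw hy h.1 h.2

theorem inf_le_of_strictlyBetween {b y w z : L} (hy : y ⋖ b) (hw : w ⋖ b) (hz : z ⋖ b)
    (h : StrictlyBetween (D.inclination · b) y w z) : y ⊓ z ≤ w := by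
  rcases h with h | h
  · exact D.inf_le_of_covBy hy hw hz h.1 h.2
  · exact inf_comm y z ▸ D.inf_le_of_covBy hz hw hy h.1 h.2

/-! ### SL-steps stay inside the congruence -/

theorem SwingsTo.con {r s : PrimeInterval L} (h : D.SwingsTo r s) {c : LatticeCon L}
    (hc : c.r r.bot r.top) : c.r s.bot s.top := by
  obtain ⟨⟨S, -, hne, -⟩, htop, -, hinner⟩ := h
  obtain ⟨u, x, hu⟩ := r
  obtain ⟨v, x', hv⟩ := s
  dsimp only at htop hinner hc ⊢
  subst htop
  have huv : u ≠ v := fun h => hne (PrimeInterval.ext h rfl)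
  obtain ⟨d, e, hd, he, hdv, hve⟩ := IsInnerLowerCover.exists_lt_lt hinner hv
  -- The auxiliary lower cover is taken on the side of `v` opposite to `u`.
  rcases lt_trichotomy (D.inclination u x) (D.inclination v x) with hlt | heq | hlt
  · exact con_of_inf_le hv he (fun h => hve.ne (h ▸ rfl)) (D.inf_le_of_covBy hu hv he hlt hve) hc
  · exact absurd (D.inclination_right_injOn x hu hv heq) huv
  · exact con_of_inf_le hv hd (fun h => hdv.ne (h ▸ rfl))
      (inf_comm u d ▸ D.inf_le_of_covBy hd hv hu hdv hlt) hc

theorem TiltsTo.con {r s : PrimeInterval L} (h : D.TiltsTo r s) {c : LatticeCon L}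
    (hc : c.r r.bot r.top) : c.r s.bot s.top := by
  obtain ⟨⟨S, -, hne, -⟩, hbot, -, hinner⟩ := h
  obtain ⟨x, u, hu⟩ := r
  obtain ⟨x', v, hv⟩ := s
  dsimp only at hbot hinner hc ⊢
  subst hbot
  have huv : u ≠ v := fun h => hne (PrimeInterval.ext rfl h)
  obtain ⟨d, e, hd, he, hdv, hve⟩ := IsInnerCover.exists_lt_lt hinner hv
  rcases lt_trichotomy (D.inclination x u) (D.inclination x v) with hlt | heq | hlt
  · exact con_of_le_sup hv he (fun h => hve.ne (h ▸ rfl)) (D.le_sup_of_covBy hu hv he hlt hve) hc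
  · exact absurd (D.inclination_left_injOn x hu hv heq) huv
  · exact con_of_le_sup hv hd (fun h => hdv.ne (h ▸ rfl))
      (sup_comm u d ▸ D.le_sup_of_covBy hd hv hu hdv hlt) hc

theorem CellPerspective.con {r s : PrimeInterval L} (h : D.CellPerspective r s) {c : LatticeCon L}
    (hc : c.r r.bot r.top) : c.r s.bot s.top := by
  obtain ⟨S, ⟨hS, -, hrb, hrt, hsb, hst⟩, hdisj⟩ := h
  obtain ⟨a, b, y, z, rfl, hyz, hay, hyb, haz, hzb⟩ := hS.exists_eq
  have hedge : ∀ q : PrimeInterval L, q.bot ∈ ({a, y, z, b} : Set L) →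
      q.top ∈ ({a, y, z, b} : Set L) → (q.bot = a ∧ q.top = y) ∨ (q.bot = a ∧ q.top = z) ∨
        (q.bot = y ∧ q.top = b) ∨ (q.bot = z ∧ q.top = b) := by
    rintro ⟨u, v, huv⟩ hu hv
    -- This rules out the diagonal `[a, b]`, which is not an edge.
    have h1 : ¬ b ≤ v ∨ u ≠ a := by
      by_contra! h
      obtain ⟨h1, rfl⟩ := h
      exact huv.2 hay.lt (hyb.lt.trans_le h1)
    have hyz1 : ¬ y < z := fun h => haz.2 hay.lt h
    have hyz2 : ¬ z < y := fun h => hay.2 haz.lt h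
    have hlt := huv.lt
    dsimp only at hu hv ⊢
    rcases hu with rfl | rfl | rfl | rfl
    · rcases hv with rfl | rfl | rfl | rfl
      exacts [hlt.false.elim, .inl ⟨rfl, rfl⟩, .inr (.inl ⟨rfl, rfl⟩),
        (h1.elim (· le_rfl) (· rfl)).elim]
    · rcases hv with rfl | rfl | rfl | rfl
      exacts [(hlt.trans hay.lt).false.elim, hlt.false.elim, (hyz1 hlt).elim,
        .inr (.inr (.inl ⟨rfl, rfl⟩))]
    · rcases hv with rfl | rfl | rfl | rfl
      exacts [(hlt.trans haz.lt).false.elim, (hyz2 hlt).elim, hlt.false.elim,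
        .inr (.inr (.inr ⟨rfl, rfl⟩))]
    · rcases hv with rfl | rfl | rfl | rfl
      exacts [((hlt.trans hay.lt).trans hyb.lt).false.elim, (hlt.trans hyb.lt).false.elim,
        (hlt.trans hzb.lt).false.elim, hlt.false.elim]
  have hup : ∀ {p q : L}, a ⋖ p → a ⋖ q → p ⋖ b → q ⋖ b → p ≠ q → c.r a p → c.r q b :=
    fun {p q} h1 h2 h3 h4 h5 h => by
      have h6 := c.sup h (c.iseqv.refl q)
      rwa [sup_eq_right.2 h2.le, h3.sup_eq_of_ne h4 h5] at h6
  have hdown : ∀ {p q : L}, a ⋖ p → a ⋖ q → p ⋖ b → q ⋖ b → p ≠ q → c.r q b → c.r a p :=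
    fun {p q} h1 h2 h3 h4 h5 h => by
      have h6 := c.inf h (c.iseqv.refl p)
      rwa [inf_eq_right.2 h3.le, inf_comm, h1.inf_eq_of_ne h2 h5] at h6
  have hne : r.bot ≠ s.bot ∧ r.bot ≠ s.top ∧ r.top ≠ s.bot ∧ r.top ≠ s.top := by
    simp only [Set.disjoint_insert_left, Set.disjoint_singleton_left, Set.mem_insert_iff,
      Set.mem_singleton_iff, not_or, and_assoc] at hdisj
    exact hdisj
  obtain ⟨n1, n2, n3, n4⟩ := hne
  -- Of the sixteen pairs of sides, only the four without a common endpoint survive.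
  rcases hedge r hrb hrt with ⟨e1, e2⟩ | ⟨e1, e2⟩ | ⟨e1, e2⟩ | ⟨e1, e2⟩ <;>
    rcases hedge s hsb hst with ⟨e3, e4⟩ | ⟨e3, e4⟩ | ⟨e3, e4⟩ | ⟨e3, e4⟩ <;>
    rw [e1, e2] at hc <;> rw [e1, e3] at n1 <;> rw [e1, e4] at n2 <;> rw [e2, e3] at n3 <;>
    rw [e2, e4] at n4 <;> rw [e3, e4] <;>
    try first | exact absurd rfl n1 | exact absurd rfl n2 | exact absurd rfl n3 | exact absurd rfl n4
  · exact hup hay haz hyb hzb hyz hc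
  · exact hup haz hay hzb hyb hyz.symm hc
  · exact hdown haz hay hzb hyb hyz.symm hc
  · exact hdown hay haz hyb hzb hyz hc

theorem SLStep.con {r s : PrimeInterval L} (h : D.SLStep r s) {c : LatticeCon L}
    (hc : c.r r.bot r.top) : c.r s.bot s.top := by
  rcases h with h | h | h
  exacts [h.con hc, h.con hc, h.con hc]

/-! ### Semimodularity: adjacent covers, and closure of the reached chains under joins and meets. -/

variable [IsUpperModularLattice L]

theorem exists_isFourCell_of_covers {x y z : L} (hy : x ⋖ y) (hz : x ⋖ z) (hne : y ≠ z)
    (hadj : ∀ w ∈ {w | x ⋖ w}, ¬ StrictlyBetween (D.inclination x) y w z) :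
    ∃ S, D.IsFourCell S ∧ x ∈ S ∧ y ∈ S ∧ z ∈ S ∧ y ⊔ z ∈ S := by
  have hyt : y ⋖ y ⊔ z := covBy_sup_of_inf_covBy_right (by rwa [hy.inf_eq_of_ne hz hne])
  have hzt : z ⋖ y ⊔ z := covBy_sup_of_inf_covBy_left (by rwa [hy.inf_eq_of_ne hz hne])
  rcases lt_trichotomy (D.inclination x y) (D.inclination x z) with h | h | h
  · refine ⟨_, D.isFourCell_of_adjacent_covers hy hyt hz hzt h fun w hw h1 h2 =>
      hadj w hw (.inl ⟨h1, h2⟩), ?_⟩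
    simp
  · exact absurd (D.inclination_left_injOn x hy hz h) hne
  · refine ⟨_, D.isFourCell_of_adjacent_covers hz hzt hy hyt h fun w hw h1 h2 =>
      hadj w hw (.inr ⟨h1, h2⟩), ?_⟩
    simp

/-- Adjacent lower covers cover their meet. -/
theorem inf_covBy_of_adjacent {x y z : L} (hy : y ⋖ x) (hz : z ⋖ x) (hne : y ≠ z)
    (hadj : ∀ w ∈ {w | w ⋖ x}, ¬ StrictlyBetween (D.inclination · x) y w z) :
    y ⊓ z ⋖ y ∧ y ⊓ z ⋖ z := by
  have hny : ¬ y ≤ z := fun h => (hy.eq_or_eq h hz.le).elim hne.symm hz.ne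
  have hnz : ¬ z ≤ y := fun h => (hz.eq_or_eq h hy.le).elim hne hy.ne
  obtain ⟨u, hu, huy⟩ := exists_covBy_le_of_lt (inf_lt_left.2 hny)
  obtain ⟨v, hv, hvz⟩ := exists_covBy_le_of_lt (inf_lt_right.2 hnz)
  have huz : ¬ u ≤ z := fun h => hu.lt.not_ge (le_inf huy h)
  have hvy : ¬ v ≤ y := fun h => hv.lt.not_ge (le_inf h hvz)
  have huv : u ≠ v := fun h => huz (h.trans_le hvz)
  have h1 : u ⋖ u ⊔ v := covBy_sup_of_inf_covBy_right (by rwa [hu.inf_eq_of_ne hv huv])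
  have h2 : v ⋖ u ⊔ v := covBy_sup_of_inf_covBy_left (by rwa [hu.inf_eq_of_ne hv huv])
  rcases (sup_le (huy.trans hy.le) (hvz.trans hz.le) : u ⊔ v ≤ x).eq_or_lt with h | h
  · rw [h] at h1 h2
    have hyu : y = u := (h1.eq_or_eq huy hy.le).resolve_right hy.ne
    have hzv : z = v := (h2.eq_or_eq hvz hz.le).resolve_right hz.ne
    exact ⟨hyu.symm ▸ hu, hzv.symm ▸ hv⟩
  · exfalso
    -- This `w` is a third lower cover above both `u` and `v`. By adjacency it is not between `y`
    -- and `z`, so one of these, say `y`, is between `w` and the other; then `v ≤ w ⊓ z ≤ y`, which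
    -- is impossible.
    obtain ⟨w, hw, hwx⟩ := exists_le_covBy_of_lt h
    have hwu : u ≤ w := le_sup_left.trans hw
    have hwv : v ≤ w := le_sup_right.trans hw
    have hwy : w ≠ y := fun h => hvy (h ▸ hwv)
    have hwz : w ≠ z := fun h => huz (h ▸ hwu)
    have n1 : D.inclination w x ≠ D.inclination y x := fun h =>
      hwy (D.inclination_right_injOn x hwx hy h)
    have n2 : D.inclination w x ≠ D.inclination z x := fun h =>
      hwz (D.inclination_right_injOn x hwx hz h)
    have n3 : D.inclination y x ≠ D.inclination z x := fun h =>
      hne (D.inclination_right_injOn x hy hz h)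
    have h3 := hadj w hwx
    have h4 : ¬ StrictlyBetween (D.inclination · x) w y z := fun h =>
      hvy ((le_inf hwv hvz).trans (inf_le_of_strictlyBetween hwx hy hz h))
    have h5 : ¬ StrictlyBetween (D.inclination · x) w z y := fun h =>
      huz ((le_inf hwu huy).trans (inf_le_of_strictlyBetween hwx hz hy h))
    unfold StrictlyBetween at h3 h4 h5
    grind

theorem exists_isFourCell_of_lower_covers {x y z : L} (hy : y ⋖ x) (hz : z ⋖ x) (hne : y ≠ z)
    (hadj : ∀ w ∈ {w | w ⋖ x}, ¬ StrictlyBetween (D.inclination · x) y w z) :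
    ∃ S, D.IsFourCell S ∧ x ∈ S ∧ y ∈ S ∧ z ∈ S ∧ y ⊓ z ∈ S := by
  obtain ⟨hyt, hzt⟩ := inf_covBy_of_adjacent hy hz hne hadj
  rcases lt_trichotomy (D.inclination y x) (D.inclination z x) with h | h | h
  · refine ⟨_, D.isFourCell_of_adjacent_lower_covers hzt hz hyt hy h fun w hw h1 h2 =>
      hadj w hw (.inl ⟨h1, h2⟩), ?_⟩
    simp
  · exact absurd (D.inclination_right_injOn x hy hz h) hne
  · refine ⟨_, D.isFourCell_of_adjacent_lower_covers hyt hy hzt hz h fun w hw h1 h2 =>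
      hadj w hw (.inr ⟨h1, h2⟩), ?_⟩
    simp

theorem Reaches.sup_of_covBy {x y z : L} (h : D.Reaches p x y) (hz : x ⋖ z) (hne : y ≠ z) :
    D.Reaches p z (y ⊔ z) := by
  have hy := h.1
  refine (strictlyBetween_induction (D.inclination x) (S := {w | x ⋖ w})
    -- The second conjunct keeps the induction going: an intermediate cover is inner, so the edge to
    -- it is reached and serves as a new start.
    (T := fun y z => D.Reaches p x y → D.Reaches p z (y ⊔ z) ∧
      (D.IsInnerCover x z → D.Reaches p x z)) ?_ ?_ hy hz hne h).1
  · rintro y hy z hz hne hadj ⟨_, hr⟩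
    obtain ⟨S, hS, hxS, hyS, hzS, htS⟩ := exists_isFourCell_of_covers hy hz hne hadj
    have hzt : z ⋖ y ⊔ z := covBy_sup_of_inf_covBy_left (by
      rw [hy.inf_eq_of_ne hz hne]
      exact hy)
    refine ⟨⟨hzt, hr.tail (.inl ⟨S, ⟨hS, ?_, hxS, hyS, hzS, htS⟩, ?_⟩)⟩,
      fun hinner => ⟨hz, hr.tail (.inr (.inr ⟨⟨S, hS, ?_, hxS, hyS, hxS, hzS⟩, rfl, ?_, hinner⟩))⟩⟩
    · exact fun h => hz.ne (congrArg PrimeInterval.bot h)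
    · simp only [Set.disjoint_insert_left, Set.disjoint_singleton_left, Set.mem_insert_iff,
        Set.mem_singleton_iff, not_or]
      have hyt : y ≠ y ⊔ z := fun h =>
        (hy.eq_or_eq hz.le (h ▸ le_sup_right : z ≤ y)).elim hz.ne' hne.symm
      exact ⟨⟨hz.ne, (hz.lt.trans hzt.lt).ne⟩, hne, hyt⟩
    · exact fun h => hne (congrArg PrimeInterval.top h)
    · obtain ⟨c, e, hc, he, h1, h2⟩ := hinner.exists_lt_lt hz
      exact three_le_encard hc hz he h1 h2
  · intro y hy w hw z hz hb hyw hwz h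
    obtain ⟨h1, h2⟩ := hwz ((hyw h).2 (isInnerCover_of_strictlyBetween hy hz hb))
    refine ⟨?_, h2⟩
    have hyz : y ≠ z := by
      rintro rfl
      rcases hb with hb | hb
      exacts [(hb.1.trans hb.2).false, (hb.1.trans hb.2).false]
    have hzt : z ⋖ y ⊔ z := covBy_sup_of_inf_covBy_left (by
      rw [hy.inf_eq_of_ne hz hyz]
      exact hy)
    -- Planarity puts `w` below `y ⊔ z`. Since `z ⋖ y ⊔ z`, the edge obtained through `w` is the
    -- desired one.
    have hle : w ⊔ z ≤ y ⊔ z := sup_le (le_sup_of_strictlyBetween hy hw hz hb) le_sup_right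
    rwa [(hzt.eq_or_eq le_sup_right hle).resolve_left h1.1.ne'] at h1

/-- The edge is pushed up towards `w` one cover at a time; by semimodularity it stays an edge until
it collapses or its bottom is `w`. -/
theorem Reaches.sup_of_le {u v w : L} (h : D.Reaches p u v) (huw : u ≤ w) :
    D.ReachesChain p w (v ⊔ w) := by
  induction u using WellFoundedGT.induction generalizing v with
  | ind u ih =>
  rcases huw.eq_or_lt with rfl | hlt
  · rw [sup_eq_left.2 h.1.le]
    exact .single h
  · obtain ⟨z, hz, hzw⟩ := exists_covBy_le_of_lt hlt
    by_cases hvz : v = z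
    · rw [sup_eq_right.2 (hvz.trans_le hzw)]
      exact .refl
    · have h1 := ih z hz.lt (h.sup_of_covBy hz hvz) hzw
      rwa [sup_assoc, sup_eq_right.2 hzw] at h1

theorem ReachesChain.sup {u v : L} (h : D.ReachesChain p u v) (w : L) :
    D.ReachesChain p (u ⊔ w) (v ⊔ w) := by
  induction h with
  | refl => exact .refl
  | tail _ h ih =>
    have h1 := h.sup_of_le (w := _ ⊔ w) le_sup_left
    rw [← sup_assoc, sup_eq_left.2 h.1.le] at h1
    exact ih.trans h1

/-- The analogue of `Reaches.sup_of_covBy` with swings. Its conclusion is a chain rather than an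
edge, because `y ⊓ z` need not be covered by `z`. -/
theorem Reaches.inf_of_covBy {x : L}
    (ih : ∀ x' < x, ∀ u w : L, D.Reaches p u x' → w ≤ x' → D.ReachesChain p (u ⊓ w) w)
    {y z : L} (h : D.Reaches p y x) (hz : z ⋖ x) (hne : y ≠ z) :
    D.ReachesChain p (y ⊓ z) z := by
  have hy := h.1
  refine (strictlyBetween_induction (D.inclination · x) (S := {w | w ⋖ x})
    (T := fun y z => D.Reaches p y x → D.ReachesChain p (y ⊓ z) z ∧
      (D.IsInnerLowerCover z x → D.Reaches p z x)) ?_ ?_ hy hz hne h).1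
  · rintro y hy z hz hne hadj ⟨_, hr⟩
    obtain ⟨S, hS, hxS, hyS, hzS, htS⟩ := exists_isFourCell_of_lower_covers hy hz hne hadj
    have hyt := (inf_covBy_of_adjacent hy hz hne hadj).1
    have hzt := (inf_covBy_of_adjacent hy hz hne hadj).2
    refine ⟨.single ⟨hzt, hr.tail (.inl ⟨S, ⟨hS, ?_, hyS, hxS, htS, hzS⟩, ?_⟩)⟩,
      fun hinner => ⟨hz, hr.tail (.inr (.inl ⟨⟨S, hS, ?_, hyS, hxS, hzS, hxS⟩, rfl, ?_, hinner⟩))⟩⟩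
    · exact fun h => hz.ne' (congrArg PrimeInterval.top h)
    · simp only [Set.disjoint_insert_left, Set.disjoint_singleton_left, Set.mem_insert_iff,
        Set.mem_singleton_iff, not_or]
      exact ⟨⟨hyt.ne', hne⟩, (hyt.lt.trans hy.lt).ne', hz.ne'⟩
    · exact fun h => hne (congrArg PrimeInterval.bot h)
    · obtain ⟨c, e, hc, he, h1, h2⟩ := hinner.exists_lt_lt hz
      exact three_le_encard (φ := (D.inclination · x)) hc hz he h1 h2
  · intro y hy w hw z hz hb hyw hwz h
    obtain ⟨h0, h3⟩ := hyw h
    obtain ⟨h1, h2⟩ := hwz (h3 (isInnerLowerCover_of_strictlyBetween hy hz hb))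
    refine ⟨?_, h2⟩
    have hle : y ⊓ z ≤ w := inf_le_of_strictlyBetween hy hw hz hb
    -- The chain from `y ⊓ w` to `w` lies below `x`, so `ih` allows meeting it with `z`. As `y ⊓ z ≤
    -- w`, this leads from `y ⊓ z` to `w ⊓ z`, and the chain up to `z` completes it.
    have h4 := ReachesChain.inf_of_forall ih h0 hw.lt z
    rw [inf_right_comm, inf_eq_left.2 hle] at h4
    exact h4.trans h1

theorem Reaches.inf_of_le {u x w : L} (h : D.Reaches p u x) (hwx : w ≤ x) :
    D.ReachesChain p (u ⊓ w) w := by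
  induction x using WellFoundedLT.induction generalizing u w with
  | ind x ih =>
  have ih' : ∀ x' < x, ∀ u w : L, D.Reaches p u x' → w ≤ x' → D.ReachesChain p (u ⊓ w) w :=
    fun x' hx' u w => ih x' hx'
  rcases hwx.eq_or_lt with rfl | hlt
  · rw [inf_eq_left.2 h.1.le]
    exact .single h
  · obtain ⟨z, hwz, hz⟩ := exists_le_covBy_of_lt hlt
    by_cases huz : u = z
    · rw [inf_eq_right.2 (hwz.trans_eq huz.symm)]
      exact .refl
    · have h1 := ReachesChain.inf_of_forall ih' (h.inf_of_covBy ih' hz huz) hz.lt w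
      rwa [inf_assoc, inf_eq_right.2 hwz] at h1

theorem ReachesChain.inf {u v : L} (h : D.ReachesChain p u v) (w : L) :
    D.ReachesChain p (u ⊓ w) (v ⊓ w) := by
  induction h with
  | refl => exact .refl
  | @tail s t _ h ih =>
    have h1 := h.inf_of_le (w := t ⊓ w) inf_le_left
    rw [← inf_assoc, inf_eq_left.2 h.1.le] at h1
    exact ih.trans h1

variable (D p) in
/-- The congruence that collapses the edges that can be reached from `p`. -/
def reachesCon : LatticeCon L :=
  haveI : Std.Refl fun x y : L => D.ReachesChain p (x ⊓ y) (x ⊔ y) :=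
    ⟨fun x => by rw [inf_idem, sup_idem]; exact .refl⟩
  -- By this criterion, transitivity and compatibility need checking only for comparable elements,
  -- where the relation is `ReachesChain` itself.
  LatticeCon.mk' (fun x y => D.ReachesChain p (x ⊓ y) (x ⊔ y))
    (fun x y => by rw [inf_eq_left.2 inf_le_sup, sup_eq_right.2 inf_le_sup])
    (fun x y z hxy hyz h₁ h₂ => by
      rw [inf_eq_left.2 hxy, sup_eq_right.2 hxy] at h₁
      rw [inf_eq_left.2 hyz, sup_eq_right.2 hyz] at h₂
      rw [inf_eq_left.2 (hxy.trans hyz), sup_eq_right.2 (hxy.trans hyz)]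
      exact h₁.trans h₂)
    (fun x y t hxy h => by
      rw [inf_eq_left.2 hxy, sup_eq_right.2 hxy] at h
      rw [inf_eq_left.2 (inf_le_inf_right t hxy), sup_eq_right.2 (inf_le_inf_right t hxy),
        inf_eq_left.2 (sup_le_sup_right hxy t), sup_eq_right.2 (sup_le_sup_right hxy t)]
      exact ⟨h.inf t, h.sup t⟩)

theorem con_iff_reflTransGen (D : PlanarDiagram L) (p q : PrimeInterval L) :
    p.con.r q.bot q.top ↔ Relation.ReflTransGen D.SLStep p q := by
  constructor
  · intro h
    have h1 : D.ReachesChain p (p.bot ⊓ p.top) (p.bot ⊔ p.top) := by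
      rw [inf_eq_left.2 p.covBy.le, sup_eq_right.2 p.covBy.le]
      exact .single ⟨p.covBy, .refl⟩
    have h2 : D.ReachesChain p (q.bot ⊓ q.top) (q.bot ⊔ q.top) := h (D.reachesCon p) h1
    rw [inf_eq_left.2 q.covBy.le, sup_eq_right.2 q.covBy.le] at h2
    exact (h2.reaches q.covBy).2
  · intro h c hc
    induction h with
    | refl => exact hc
    | tail _ h ih => exact h.con ih

end PlanarDiagram

/-! ### From the reflexive transitive closure to finite sequences. -/

theorem Relation.reflTransGen_iff_exists_fin {α : Type*} {R : α → α → Prop} {a b : α} :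
    Relation.ReflTransGen R a b ↔ ∃ (n : ℕ) (r : Fin (n + 1) → α),
      (∀ i : Fin n, R (r i.castSucc) (r i.succ)) ∧ r 0 = a ∧ r (Fin.last n) = b := by
  constructor
  · intro h
    induction h with
    | refl => exact ⟨0, fun _ => a, fun i => i.elim0, rfl, rfl⟩
    | @tail b c _ hbc ih =>
      obtain ⟨n, r, hr, h0, hn⟩ := ih
      refine ⟨n + 1, Fin.snoc (α := fun _ => α) r c, fun i => ?_, ?_, Fin.snoc_last _ _⟩
      · induction i using Fin.lastCases with
        | last => rwa [Fin.succ_last, Fin.snoc_last, Fin.snoc_castSucc, hn]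
        | cast i => rw [Fin.succ_castSucc, Fin.snoc_castSucc, Fin.snoc_castSucc]; exact hr i
      · rw [← Fin.castSucc_zero, Fin.snoc_castSucc, h0]
  · rintro ⟨n, r, hr, rfl, rfl⟩
    induction Fin.last n using Fin.induction with
    | zero => exact .refl
    | succ i ih => exact ih.tail (hr i)

theorem mainTheorem2 {L : Type*} [Lattice L] [Finite L] [IsUpperModularLattice L]
    (D : PlanarDiagram L) (p q : PrimeInterval L) :
    p.con.r q.bot q.top ↔
      ∃ (n : ℕ) (r : Fin (n + 1) → PrimeInterval L),
        D.IsSLSequence r ∧ r 0 = p ∧ r (Fin.last n) = q := by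
  rw [PlanarDiagram.con_iff_reflTransGen D, Relation.reflTransGen_iff_exists_fin]
  rfl
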